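/- Let $\mathbb{Z}^\times$ be the set of non-zero integers, and let $W$ be the group of permutations of $\mathbb{Z}^\times$ generated by $s_i$ $(i\in\mathbb{Z})$, where $s_i=(i\ \,i{+}1)$ for $i>0$, $s_0=(-1\ \,1)$ and $s_i=(i{-}1\ \,i)$ for $i<0$ (the Weyl group of $\mathfrak{gl}_\infty$), with length function $\ell$. Let $\Lambda_0$ be the $0$th fundamental weight, so that $s_i$ fixes $\Lambda_0$ if and only if $i\neq 0$, and let $W^{\Lambda_0}=\{w\in W \mid \ell(ws_i)>\ell(w)\text{ whenever } s_i\Lambda_0=\Lambda_0\}$. For $w\in W^{\Lambda_0}$ let $\lambda(w)$ be the partition with parts $\lambda(w)_i=|\{j\in\mathbb{Z}^\times \mid -i<w^{-1}(j),\ j<w(-i)\}|$ $(i\geq 1)$, let $d=d(w)$ be the number of boxes on its main diagonal, and put $\alpha_i=\lambda(w)'_i-i+1$, $\beta_i=\lambda(w)_i-i+1$ for $1\le i\le d$, where $\lambda(w)'$ is the conjugate partition. Let $\phi(w)=(\alpha_d,\ldots,\alpha_1)$ and $\psi(w)=(\beta_d,\ldots,\beta_1)$. A semi-infinite word $\cdots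 w_{-2}w_{-1}$ is a strictly increasing sequence in $\mathbb{Z}^\times$ with $w_k=k+c$ for some integer $c$ and all $k\ll 0$. Semi-infinite words form a $\mathfrak{gl}_\infty$-crystal (the crystal of the Fock space): $\widetilde f_i$ replaces the letter $k$ by $k'$, where $s_i=(k\ \,k')$, $k<k'$, if $k$ occurs and $k'$ does not, and is $\mathbf 0$ otherwise. Let $H_{\Lambda_0}=\cdots{-3}\,{-2}\,{-1}$, and let $\mathbf{B}(\Lambda_0)$ be its connected component. For $n\geq 1$ let $\mathbf{B}(n\Lambda_0)$ be the set of tensor products $\mathbf{w}=w^{(1)}\otimes\cdots\otimes w^{(n)}$ of elements of $\mathbf{B}(\Lambda_0)$ with $w^{(i+1)}_k\le w^{(i)}_k$ for $1\le i<n$ and $k<0$. The operators $\widetilde f_i$ act on tensor products by the tensor product rule: $\widetilde f_i(b_1\otimes b_2)=\widetilde f_ib_1\otimes b_2$ if $\varphi_i(b_1)>\varepsilon_i(b_2)$, and $=b_1\otimes\widetilde f_ib_2$ otherwise, where $\varepsilon_i(b)$ (resp. $\varphi_i(b)$) is the number of $i$-arrows that can be followed backwards (resp. forwards) from $b$. Put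 $H_{n\Lambda_0}=H_{\Lambda_0}\otimes\cdots\otimes H_{\Lambda_0}$ ($n$ factors). For a reduced expression $w=s_{i_1}\cdots s_{i_r}$ of $w\in W^{\Lambda_0}$, the Demazure crystal is $$\mathbf{B}_w(n\Lambda_0)=\{\widetilde f_{i_1}^{m_1}\cdots\widetilde f_{i_r}^{m_r}H_{n\Lambda_0}\mid m_1,\ldots,m_r\ge 0\}\setminus\{\mathbf 0\}.$$ For a partition $\nu$ with at most $d$ parts let $\nu^\pi$ be its rotation by $180^\circ$. Let $SST_{\mathbf{B}_{>0}}(\nu^\pi)_{\psi}$ (resp. $SST_{\mathbf{B}^\vee_{<0}}(\nu^\pi)_{\phi}$) be the set of semistandard tableaux of shape $\nu^\pi$ (rows weakly increasing from left to right, columns strictly increasing from top to bottom) with entries in $\{1<2<\cdots\}$ (resp. $\{-1^\vee<-2^\vee<\cdots\}$) such that the entries in the $i$-th row from the bottom are at most $\psi_{d-i+1}$ (resp. $-\phi_{d-i+1}^\vee$) for $1\le i\le d$. **Proposition.** Let $w\in W^{\Lambda_0}$, $d=d(w)$, $\phi=\phi(w)$, $\psi=\psi(w)$ and $n\ge 1$.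 For every reduced expression of $w$, the set $\mathbf{B}_w(n\Lambda_0)$ is contained in $\mathbf{B}(n\Lambda_0)$, and there is a bijection $$\mathbf{B}_w(n\Lambda_0)\longleftrightarrow\bigsqcup_{\nu\subset(n^d)}SST_{\mathbf{B}^\vee_{<0}}(\nu^\pi)_{\phi}\times SST_{\mathbf{B}_{>0}}(\nu^\pi)_{\psi},\qquad \mathbf{w}\longmapsto(\mathbf{w}_{<0}^\vee,\mathbf{w}_{>0}),$$ where the union is over the partitions $\nu$ with at most $d$ parts, all of them at most $n$. Here the $k$-th column from the right of $\mathbf{w}_{>0}$ consists of the positive letters of $w^{(k)}$, and the $k$-th column from the right of $\mathbf{w}_{<0}^\vee$ consists of the $-m^\vee$ $(m\geq 1)$ such that $-m$ is not a letter of $w^{(k)}$. -/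

import Mathlib

namespace GlInf

noncomputable section

/-! ### The index set of non-zero integers and the Weyl group -/

/-- The set of non-zero integers, with its usual order. It indexes the coordinates
`ε_k` of the dual Cartan subalgebra and is also the set of letters of the vector crystal. -/
abbrev NZInt : Type := {k : ℤ // k ≠ 0}

/-- Source of the `i`-coloured arrow of the vector crystal
`⋯ → -2 → -1 → 1 → 2 → ⋯`. Thus `α_i = ε_(lo i) - ε_(hi i)`. -/
def lo (i : ℤ) : NZInt :=
  if h : 0 < i then ⟨i, by omega⟩
  else if i = 0 then ⟨-1, by omega⟩
  else ⟨i - 1, by omega⟩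

/-- Target of the `i`-coloured arrow of the vector crystal. -/
def hi (i : ℤ) : NZInt :=
  if h : 0 < i then ⟨i + 1, by omega⟩
  else if h0 : i = 0 then ⟨1, by omega⟩
  else ⟨i, h0⟩

theorem lo_lt_hi (i : ℤ) : lo i < hi i := by
  rw [← Subtype.coe_lt_coe]
  unfold lo hi
  split_ifs <;> simp

/-- `hi i` is the immediate successor of `lo i` among the non-zero integers. -/
theorem hi_le_of_lo_lt (i : ℤ) (x : NZInt) (h : lo i < x) : hi i ≤ x := by
  rw [← Subtype.coe_lt_coe] at h
  rw [← Subtype.coe_le_coe]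
  have hx := x.2
  revert h
  unfold lo hi
  split_ifs <;> simp <;> omega

/-- The simple reflection `s_i`, acting on non-zero integers as the transposition of
`lo i` and `hi i`. -/
def simpleReflection (i : ℤ) : Equiv.Perm NZInt := Equiv.swap (lo i) (hi i)

/-- The Weyl group, as a group of permutations of the non-zero integers. -/
def weylGroup : Subgroup (Equiv.Perm NZInt) :=
  Subgroup.closure (Set.range simpleReflection)

/-- The product `s_{i_1} ⋯ s_{i_r}`. -/
def wordProd (word : List ℤ) : Equiv.Perm NZInt := (word.map simpleReflection).prod

/-- The length of an element of the Weyl group. -/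
def weylLength (w : Equiv.Perm NZInt) : ℕ :=
  sInf {r | ∃ word : List ℤ, word.length = r ∧ wordProd word = w}

/-- `w = s_{i_1} ⋯ s_{i_r}` is a reduced expression. -/
def IsReducedWord (w : Equiv.Perm NZInt) (word : List ℤ) : Prop :=
  wordProd word = w ∧ word.length = weylLength w

/-- The weight `Λ_0`, through its values on the diagonal matrix units `E_kk`. -/
def Lambda0 (k : NZInt) : ℚ := if k.1 < 0 then 1 / 2 else -1 / 2

/-- The action of a permutation on weights given by their values on the `E_kk`, so that
`w ε_k = ε_(w k)`. -/
def actWeight (w : Equiv.Perm NZInt) (lam : NZInt → ℚ) : NZInt → ℚ := fun k => lam (w⁻¹ k)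

/-- `W^{Λ_0}`: the `w ∈ W` with `ℓ(w s_i) > ℓ(w)` for all `s_i` in the stabilizer of `Λ_0`. -/
def minimalReps : Set (Equiv.Perm NZInt) :=
  {w | w ∈ weylGroup ∧ ∀ i : ℤ, actWeight (simpleReflection i) Lambda0 = Lambda0 →
    weylLength w < weylLength (w * simpleReflection i)}

/-! ### The partition attached to a permutation, and its Frobenius coordinates

Rows, columns and parts are numbered from `0`. -/

/-- The diagram `D(w) = {(i, j) | i < w⁻¹(j), j < w(i)}`. -/
def diagram (w : Equiv.Perm NZInt) : Set (NZInt × NZInt) :=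
  {p | p.1 < w⁻¹ p.2 ∧ p.2 < w p.1}

/-- The non-zero integer `-(r+1)`. -/
def negIdx (r : ℕ) : NZInt := ⟨-((r : ℤ) + 1), by omega⟩

/-- The `(r+1)`-st part of the shape `λ(w)`. -/
def shapeRow (w : Equiv.Perm NZInt) (r : ℕ) : ℕ :=
  Set.ncard {j : NZInt | (negIdx r, j) ∈ diagram w}

/-- The `(c+1)`-st part of the conjugate of `λ(w)`. -/
def shapeCol (w : Equiv.Perm NZInt) (c : ℕ) : ℕ :=
  Set.ncard {r : ℕ | c < shapeRow w r}

/-- `d(w)`, the number of boxes on the main diagonal of `λ(w)`. -/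
def diagLength (w : Equiv.Perm NZInt) : ℕ := Set.ncard {r : ℕ | r < shapeRow w r}

/-- The lower Frobenius coordinates `α(w)`: with parts numbered from `1`,
`α_i = λ'_i - i + 1`. -/
def frobLower (w : Equiv.Perm NZInt) (r : ℕ) : ℕ := shapeCol w r - r

/-- The upper Frobenius coordinates `β(w)`: with parts numbered from `1`,
`β_i = λ_i - i + 1`. -/
def frobUpper (w : Equiv.Perm NZInt) (r : ℕ) : ℕ := shapeRow w r - r

/-- The flag `φ(w) = (α_d, …, α_1)`; the entry with index `k < d` is `φ_{k+1}`. -/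
def flagPhi (w : Equiv.Perm NZInt) (k : ℕ) : ℕ := frobLower w (diagLength w - 1 - k)

/-- The flag `ψ(w) = (β_d, …, β_1)`; the entry with index `k < d` is `ψ_{k+1}`. -/
def flagPsi (w : Equiv.Perm NZInt) (k : ℕ) : ℕ := frobUpper w (diagLength w - 1 - k)

/-! ### Semi-infinite words and the crystal operators -/

/-- Semi-infinite words `⋯ w_{-3} w_{-2} w_{-1}`; `letter r` is `w_{-(r+1)}`. -/
@[ext] structure SemiInfWord where
  letter : ℕ → NZInt
  strictAnti : StrictAnti letter
  eventually_shift : ∃ c : ℤ, ∃ R : ℕ, ∀ r, R ≤ r → (letter r : ℤ) = -((r : ℤ) + 1) + c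

namespace SemiInfWord

instance : Membership NZInt SemiInfWord := ⟨fun b k => ∃ r, b.letter r = k⟩

/-- `H_{Λ_0} = ⋯ -3 -2 -1`. -/
def vacuum : SemiInfWord where
  letter := negIdx
  strictAnti := by
    intro a b h
    rw [← Subtype.coe_lt_coe]
    simp only [negIdx]
    omega
  eventually_shift := ⟨0, 0, fun r _ => by simp [negIdx]⟩

open Classical in
/-- `ε_i` on semi-infinite words. Every letter occurs at most once in a word, so only
the presence of the letters `lo i` and `hi i` matters. -/
def eps (i : ℤ) (b : SemiInfWord) : ℤ := if hi i ∈ b ∧ lo i ∉ b then 1 else 0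

open Classical in
/-- `φ_i` on semi-infinite words. -/
def phi (i : ℤ) (b : SemiInfWord) : ℤ := if lo i ∈ b ∧ hi i ∉ b then 1 else 0

/-- The word obtained by replacing the letter `lo i` by `hi i`, when the latter is absent. -/
def raiseLetter (i : ℤ) (b : SemiInfWord) (h : hi i ∉ b) : SemiInfWord where
  letter r := if b.letter r = lo i then hi i else b.letter r
  strictAnti := by
    intro r s hrs
    have hlt := b.strictAnti hrs
    have hne : b.letter r ≠ hi i := fun e => h ⟨r, e⟩
    dsimp only
    split_ifs with h1 h2 h2
    · rw [h1, h2] at hlt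
      exact absurd hlt (lt_irrefl _)
    · have := hi_le_of_lo_lt i (b.letter r) (h1 ▸ hlt)
      exact lt_of_le_of_ne this (Ne.symm hne)
    · exact (h2 ▸ hlt).trans (lo_lt_hi i)
    · exact hlt
  eventually_shift := by
    obtain ⟨c, R, hR⟩ := b.eventually_shift
    by_cases hex : ∃ r, b.letter r = lo i
    · obtain ⟨r0, hr0⟩ := hex
      refine ⟨c, max R (r0 + 1), fun r hr => ?_⟩
      have hne : b.letter r ≠ lo i := by
        intro e
        have hr' := b.strictAnti.injective (e.trans hr0.symm)
        have := le_trans (le_max_right _ _) hr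
        omega
      rw [if_neg hne]
      exact hR r (le_trans (le_max_left _ _) hr)
    · refine ⟨c, R, fun r hr => ?_⟩
      rw [if_neg (fun e => hex ⟨r, e⟩)]
      exact hR r hr

open Classical in
/-- The Kashiwara operator `f̃_i` on semi-infinite words; `none` is the formal symbol `0`.
It replaces the letter `lo i` by `hi i` if the former is present and the latter absent. -/
def lower (i : ℤ) (b : SemiInfWord) : Option SemiInfWord :=
  if h : lo i ∈ b ∧ hi i ∉ b then some (raiseLetter i b h.2) else none

end SemiInfWord

/-- `𝐁(Λ_0)`: the connected component of `H_{Λ_0}` in the crystal graph of semi-infinite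
words. -/
def crystalLambda0 : Set SemiInfWord :=
  {b | Relation.EqvGen (fun x y : SemiInfWord => ∃ i : ℤ, SemiInfWord.lower i x = some y)
    SemiInfWord.vacuum b}

/-! Tensor products `w⁽¹⁾ ⊗ ⋯ ⊗ w⁽ⁿ⁾` of semi-infinite words are lists, bracketed to the right;
the empty list is the trivial crystal. The next two definitions are the tensor product rule
`ε_i(b₁ ⊗ b₂) = max (ε_i(b₁), ε_i(b₂) - ⟨wt(b₁), h_i⟩)` with
`⟨wt(b), h_i⟩ = φ_i(b) - ε_i(b)`, and `f̃_i(b₁ ⊗ b₂) = f̃_i b₁ ⊗ b₂` if `φ_i(b₁) > ε_i(b₂)`,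
`f̃_i(b₁ ⊗ b₂) = b₁ ⊗ f̃_i b₂` otherwise. -/

/-- `ε_i` on tensor products. -/
def tensorEps (i : ℤ) : List SemiInfWord → ℤ
  | [] => 0
  | b :: bs => max (SemiInfWord.eps i b)
      (tensorEps i bs - (SemiInfWord.phi i b - SemiInfWord.eps i b))

/-- The Kashiwara operator `f̃_i` on tensor products; `none` is the formal symbol `0`. -/
def tensorLower (i : ℤ) : List SemiInfWord → Option (List SemiInfWord)
  | [] => none
  | b :: bs =>
      if tensorEps i bs < SemiInfWord.phi i b then
        (SemiInfWord.lower i b).map (fun b' => b' :: bs)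
      else (tensorLower i bs).map (fun bs' => b :: bs')

/-- `𝐁(nΛ_0)`: semi-infinite semistandard tableaux of shape `(0ⁿ)`, that is, tensor products
`w⁽¹⁾ ⊗ ⋯ ⊗ w⁽ⁿ⁾` of elements of `𝐁(Λ_0)` with `w⁽ⁱ⁺¹⁾_k ≤ w⁽ⁱ⁾_k` for all `i` and `k`. -/
def crystalNLambda0 (n : ℕ) : Set (List SemiInfWord) :=
  {bs | bs.length = n ∧ (∀ b ∈ bs, b ∈ crystalLambda0) ∧
    bs.IsChain (fun b b' => ∀ r, b'.letter r ≤ b.letter r)}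

/-- The highest weight element `H_{nΛ_0} = H_{Λ_0} ⊗ ⋯ ⊗ H_{Λ_0}`. -/
def highestWeight (n : ℕ) : List SemiInfWord := List.replicate n SemiInfWord.vacuum

/-- `f̃_{i_1}^{m_1} ⋯ f̃_{i_r}^{m_r} x` for the list of pairs `(i_1, m_1), …, (i_r, m_r)`,
where `f̃_i 0 = 0`. -/
def lowerMonomial (ms : List (ℤ × ℕ)) (x : Option (List SemiInfWord)) :
    Option (List SemiInfWord) :=
  ms.foldr (fun p y => (fun z => z.bind (tensorLower p.1))^[p.2] y) x

/-- The Demazure crystal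
`𝐁_w(nΛ_0) = {f̃_{i_1}^{m_1} ⋯ f̃_{i_r}^{m_r} H_{nΛ_0} | m_1, …, m_r ≥ 0} \ {0}`
computed from an expression `w = s_{i_1} ⋯ s_{i_r}`. -/
def demazureCrystal (n : ℕ) (word : List ℤ) : Set (List SemiInfWord) :=
  {b | ∃ ms : List (ℤ × ℕ), ms.map Prod.fst = word ∧
    lowerMonomial ms (some (highestWeight n)) = some b}

/-! ### Semistandard tableaux of anti-normal shape -/

/-- Semistandard tableaux of the anti-normal shape `ν^π` with entries in `{1 < 2 < 3 < ⋯}`.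
The cell `(r, c)` of `ν` stands for the box of `ν^π` in the `(r+1)`-st row from the bottom and the
`(c+1)`-st column from the right. The same type describes tableaux with entries in
`{-1^∨ < -2^∨ < -3^∨ < ⋯}`, the number `k` standing for the letter `-k^∨`. -/
@[ext] structure AntiNormalSST (ν : YoungDiagram) where
  entry : ℕ → ℕ → ℕ
  entry_pos : ∀ r c, (r, c) ∈ ν → 1 ≤ entry r c
  entry_zero : ∀ r c, (r, c) ∉ ν → entry r c = 0
  row_weak : ∀ r c c', c < c' → (r, c') ∈ ν → entry r c' ≤ entry r c
  col_strict : ∀ r r' c, r < r' → (r', c) ∈ ν → entry r' c < entry r c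

/-- `SST(ν^π)_φ` for a flag `φ` of length `d` (`flag k` is `φ_{k+1}`): the entries in the `i`-th
row from the bottom are at most `φ_{d-i+1}`. -/
def FlaggedSST (ν : YoungDiagram) (d : ℕ) (flag : ℕ → ℕ) : Type :=
  {T : AntiNormalSST ν // ∀ r c, (r, c) ∈ ν → T.entry r c ≤ flag (d - 1 - r)}

/-- The rectangular partition `(n^d)`. -/
def rectDiagram (n d : ℕ) : YoungDiagram where
  cells := Finset.range d ×ˢ Finset.range n
  isLowerSet := by
    rintro ⟨a, b⟩ ⟨a', b'⟩ h hm
    obtain ⟨h1, h2⟩ := Prod.mk_le_mk.mp h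
    simp only [Finset.coe_product, Finset.coe_range, Set.mem_prod, Set.mem_Iio] at hm ⊢
    omega

/-- The disjoint union of `SST(ν^π)_φ × SST(ν^π)_ψ` over the partitions `ν ⊂ (n^d)`. -/
def FlaggedBitableaux (n d : ℕ) (flag₁ flag₂ : ℕ → ℕ) : Type :=
  Σ ν : {ν : YoungDiagram // ν ≤ rectDiagram n d},
    FlaggedSST ν.1 d flag₁ × FlaggedSST ν.1 d flag₂

/-- The letter `k` occurs in the word `b`. -/
def HasPos (b : SemiInfWord) (k : ℕ) : Prop := ∃ r, (b.letter r : ℤ) = k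

/-- The letter `-k` occurs in the word `b`. -/
def HasNeg (b : SemiInfWord) (k : ℕ) : Prop := ∃ r, (b.letter r : ℤ) = -(k : ℤ)

/-- The pair `(S, T)` is `(𝐰_{<0}^∨, 𝐰_{>0})` for `𝐰 = (w⁽¹⁾, …, w⁽ⁿ⁾)`: the `k`-th column from
the right of `T` consists of the positive letters of `w⁽ᵏ⁾`, and the `k`-th column from the right
of `S` consists of the `-m^∨` such that `-m` is not a letter of `w⁽ᵏ⁾`. -/
def IsBitableauOf {ν : YoungDiagram} (bs : List SemiInfWord) (S T : AntiNormalSST ν) : Prop :=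
  ∀ (k : ℕ) (hk : k < bs.length) (m : ℕ), 1 ≤ m →
    ((∃ r, (r, k) ∈ ν ∧ S.entry r k = m) ↔ ¬ HasNeg bs[k] m) ∧
    ((∃ r, (r, k) ∈ ν ∧ T.entry r k = m) ↔ HasPos bs[k] m)

end

end GlInf

namespace GlInf

/-! ### The Weyl group -/

/-! Let `b` be the extremal word, with letters `w (negIdx r)`. Everything rests on one description:
`demazureCrystal n word` is the set of chains of `n` neutral words lying letterwise below `b`
(`demazureCrystal_eq_chainsBelow`).

The description is proved by removing the first letter `i` of the reduced word. Strong exchange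
shows that `w` is increasing on the negative and on the positive integers, and that the shorter
extremal word `b'` satisfies `lower i b' = some b` (`lower_of_isReducedWord`). The chains below `b`
are then exactly the elements reached by powers of f̃_i from the chains below `b'`
(`chainsBelow_lower`): f̃_i never crosses the bound `b` because `phi i b = 0`, and once ẽ_i has been
applied until ε_i vanishes, the bound can be moved from `b` to `b'`.

The rest is bookkeeping. A neutral word amounts to two finite sets of equal size, its positive
letters and its missing negative ones. The letterwise order compares these sets separately through
their tail counts (`IsColumns.dom_iff`), so a chain is a pair of semistandard tableaux of one shape,
and lying below `b` bounds their rows by the two sets of `b`. By `exists_word_frobenius` these sets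
list the Frobenius coordinates of `λ(w)`, that is, the flags. -/

theorem perm_apply_inv {α : Type*} (w : Equiv.Perm α) (x : α) : w (w⁻¹ x) = x :=
  w.apply_symm_apply x

theorem perm_inv_apply {α : Type*} (w : Equiv.Perm α) (x : α) : w⁻¹ (w x) = x :=
  w.symm_apply_apply x

theorem le_lo_of_lt_hi (i : ℤ) (x : NZInt) (h : x < hi i) : x ≤ lo i := by
  by_contra hc
  exact absurd (hi_le_of_lo_lt i x (not_le.mp hc)) (not_le.mpr h)

/-- Since `lo i` and `hi i` are adjacent, they form the only pair whose order `s_i` reverses. -/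
theorem simpleReflection_lt {i : ℤ} {x y : NZInt} (h : x < y)
    (hne : ¬(x = lo i ∧ y = hi i)) : simpleReflection i x < simpleReflection i y := by
  have hl := lo_lt_hi i
  unfold simpleReflection
  rw [Equiv.swap_apply_def, Equiv.swap_apply_def]
  split_ifs with h1 h2 h3 h4 h5 h6 h7 h8
  · subst h1 h2; exact absurd h (lt_irrefl _)
  · exact absurd ⟨h1, h3⟩ hne
  · subst h1; exact lt_of_le_of_ne (hi_le_of_lo_lt i y h) (Ne.symm h3)
  · subst h4 h5; exact absurd (h.trans hl) (lt_irrefl _)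
  · subst h4 h6; exact absurd h (lt_irrefl _)
  · subst h4; exact hl.trans h
  · subst h7; exact h.trans hl
  · subst h8; exact lt_of_le_of_ne (le_lo_of_lt_hi i x h) h1
  · exact h

@[simp] theorem simpleReflection_inv (i : ℤ) : (simpleReflection i)⁻¹ = simpleReflection i :=
  Equiv.swap_inv _ _

@[simp] theorem simpleReflection_mul_self (i : ℤ) :
    simpleReflection i * simpleReflection i = 1 := Equiv.swap_mul_self _ _

@[simp] theorem wordProd_nil : wordProd [] = 1 := rfl

@[simp] theorem wordProd_cons (i : ℤ) (l : List ℤ) :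
    wordProd (i :: l) = simpleReflection i * wordProd l := by simp [wordProd]

/-- The strong exchange property: multiplication with the transposition of an inverted pair
removes one letter of a word. -/
theorem exists_word_swap_mul (word : List ℤ) : ∀ x y : NZInt, x < y →
    (wordProd word)⁻¹ y < (wordProd word)⁻¹ x →
    ∃ word' : List ℤ, word'.length + 1 = word.length ∧
      wordProd word' = Equiv.swap x y * wordProd word := by
  induction word with
  | nil =>
    intro x y h h'
    simp only [wordProd_nil, inv_one, Equiv.Perm.coe_one, id] at h'
    exact absurd (h.trans h') (lt_irrefl _)
  | cons j rest ih =>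
    intro x y h h'
    by_cases hxy : x = lo j ∧ y = hi j
    · refine ⟨rest, rfl, ?_⟩
      rw [hxy.1, hxy.2, wordProd_cons, ← mul_assoc]
      exact (by simp : wordProd rest = simpleReflection j * simpleReflection j * wordProd rest)
    · simp only [wordProd_cons, mul_inv_rev, simpleReflection_inv, Equiv.Perm.mul_apply] at h'
      obtain ⟨word', hl, hp⟩ := ih _ _ (simpleReflection_lt h hxy) h'
      refine ⟨j :: word', by simp [hl], ?_⟩
      -- Moving the transposition past `s_j` conjugates it to the pair to which the induction
      -- hypothesis applies.
      have hc := Equiv.swap_mul_eq_mul_swap (simpleReflection j) x y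
      rw [simpleReflection_inv] at hc
      rw [wordProd_cons, wordProd_cons, hp, ← mul_assoc, ← mul_assoc, hc]

theorem weylLength_le (word : List ℤ) : weylLength (wordProd word) ≤ word.length :=
  Nat.sInf_le ⟨word, rfl, rfl⟩

theorem exists_word_length (word : List ℤ) :
    ∃ word' : List ℤ, word'.length = weylLength (wordProd word) ∧
      wordProd word' = wordProd word :=
  Nat.sInf_mem (s := {r | ∃ l : List ℤ, l.length = r ∧ wordProd l = wordProd word})
    ⟨_, word, rfl, rfl⟩

theorem wordProd_append_singleton (word : List ℤ) (j : ℤ) :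
    wordProd (word ++ [j]) = wordProd word * simpleReflection j := by
  simp [wordProd]

theorem wordProd_mem (word : List ℤ) : wordProd word ∈ weylGroup := by
  induction word with
  | nil => exact one_mem _
  | cons i l ih =>
    rw [wordProd_cons]
    exact mul_mem (Subgroup.subset_closure ⟨i, rfl⟩) ih

theorem IsReducedWord.tail {w : Equiv.Perm NZInt} {i : ℤ} {rest : List ℤ}
    (h : IsReducedWord w (i :: rest)) : IsReducedWord (wordProd rest) rest := by
  refine ⟨rfl, le_antisymm ?_ (weylLength_le rest)⟩
  obtain ⟨word', hl, hp⟩ := exists_word_length rest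
  have h1 := weylLength_le (i :: word')
  rw [wordProd_cons, hp, ← wordProd_cons, h.1, ← h.2] at h1
  simp only [List.length_cons] at h1
  omega

/-- Write `w = s_i v`. If `s_j` did not lengthen `v` on the right, then `ℓ(w s_j) ≤ 1 + ℓ(v) ≤
ℓ(w)`, against minimality of `w`. -/
theorem minimalReps_tail {w : Equiv.Perm NZInt} {i : ℤ} {rest : List ℤ}
    (hw : w ∈ minimalReps) (h : IsReducedWord w (i :: rest)) :
    wordProd rest ∈ minimalReps := by
  refine ⟨wordProd_mem rest, fun j hj => ?_⟩
  by_contra hc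
  obtain ⟨word', hl, hp⟩ := exists_word_length (rest ++ [j])
  rw [wordProd_append_singleton] at hl hp
  have h1 := weylLength_le (i :: word')
  rw [wordProd_cons, hp, ← mul_assoc, ← wordProd_cons, h.1] at h1
  have h2 := hw.2 j hj
  have h3 := h.2
  have h4 := weylLength_le rest
  simp only [List.length_cons] at h1 h3
  omega

/-- Otherwise strong exchange would give `s_i v = w` an expression shorter than `v`. -/
theorem inv_lo_lt_inv_hi {w : Equiv.Perm NZInt} {i : ℤ} {rest : List ℤ}
    (h : IsReducedWord w (i :: rest)) :
    (wordProd rest)⁻¹ (lo i) < (wordProd rest)⁻¹ (hi i) := by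
  by_contra hc
  have hne : (wordProd rest)⁻¹ (hi i) ≠ (wordProd rest)⁻¹ (lo i) := fun e =>
    (lo_lt_hi i).ne' ((wordProd rest)⁻¹.injective e)
  obtain ⟨word', hl, hp⟩ := exists_word_swap_mul rest _ _ (lo_lt_hi i)
    (lt_of_le_of_ne (not_lt.mp hc) hne)
  have h1 := weylLength_le word'
  have h2 : wordProd word' = w := hp.trans ((wordProd_cons i rest).symm.trans h.1)
  rw [h2, ← h.2, List.length_cons] at h1
  omega

theorem actWeight_simpleReflection {i : ℤ} (hi0 : i ≠ 0) :
    actWeight (simpleReflection i) Lambda0 = Lambda0 := by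
  have hlh : ((lo i).1 < 0 ↔ (hi i).1 < 0) := by
    unfold lo hi
    split_ifs <;> simp <;> omega
  funext k
  simp only [actWeight, simpleReflection_inv, Lambda0]
  have : ((simpleReflection i k).1 < 0 ↔ k.1 < 0) := by
    unfold simpleReflection
    rw [Equiv.swap_apply_def]
    split_ifs with h1 h2
    · rw [h1]; exact hlh.symm
    · rw [h2]; exact hlh
    · rfl
  simp only [this]

/-- The transposition of `w (lo j)` and `w (hi j)` on the left of `w` is `s_j` on the right, so an
inversion here would shorten `w s_j`. Hence `w` is increasing on each sign separately. -/
theorem map_lo_lt_map_hi {w : Equiv.Perm NZInt} (hw : w ∈ minimalReps) {word : List ℤ}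
    (h : IsReducedWord w word) {j : ℤ} (hj : j ≠ 0) : w (lo j) < w (hi j) := by
  by_contra hc
  have hne : w (hi j) ≠ w (lo j) := fun e => (lo_lt_hi j).ne' (w.injective e)
  obtain ⟨word', hl, hp⟩ := exists_word_swap_mul word _ _ (lt_of_le_of_ne (not_lt.mp hc) hne)
    (by rw [h.1]; simpa using lo_lt_hi j)
  have h1 := weylLength_le word'
  have h2 := hw.2 j (actWeight_simpleReflection hj)
  have h3 : wordProd word' = w * simpleReflection j := by
    rw [hp, h.1, Equiv.swap_mul_eq_mul_swap, perm_inv_apply,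
      perm_inv_apply, Equiv.swap_comm]
    rfl
  have h4 := h.2
  rw [h3] at h1
  omega

/-- The positive integer `r + 1`. -/
def posIdx (r : ℕ) : NZInt := ⟨(r : ℤ) + 1, by omega⟩

theorem exists_negIdx_or_posIdx (x : NZInt) : (∃ r, x = negIdx r) ∨ ∃ r, x = posIdx r := by
  obtain ⟨x, hx⟩ := x
  rcases lt_or_gt_of_ne hx with h | h
  · exact Or.inl ⟨(-x - 1).toNat, Subtype.ext (by simp only [negIdx]; omega)⟩
  · exact Or.inr ⟨(x - 1).toNat, Subtype.ext (by simp only [posIdx]; omega)⟩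

theorem negIdx_lt_negIdx {r s : ℕ} : negIdx r < negIdx s ↔ s < r := by
  rw [← Subtype.coe_lt_coe]; simp only [negIdx]; omega

theorem posIdx_lt_posIdx {r s : ℕ} : posIdx r < posIdx s ↔ r < s := by
  rw [← Subtype.coe_lt_coe]; simp only [posIdx]; omega

theorem negIdx_lt_posIdx (r s : ℕ) : negIdx r < posIdx s := by
  rw [← Subtype.coe_lt_coe]; simp only [posIdx, negIdx]; omega

theorem strictAnti_map_negIdx {w : Equiv.Perm NZInt} (hw : w ∈ minimalReps) {word : List ℤ}
    (h : IsReducedWord w word) : StrictAnti fun r => w (negIdx r) := by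
  refine strictAnti_nat_of_succ_lt fun r => ?_
  have h1 : negIdx (r + 1) = lo (-((r : ℤ) + 1)) := by
    refine Subtype.ext ?_
    unfold lo
    split_ifs <;> simp only [negIdx] <;> push_cast <;> omega
  have h2 : negIdx r = hi (-((r : ℤ) + 1)) := by
    refine Subtype.ext ?_
    unfold hi
    split_ifs <;> simp only [negIdx] <;> omega
  simp only [h1, h2]
  exact map_lo_lt_map_hi hw h (by omega)

theorem strictMono_map_posIdx {w : Equiv.Perm NZInt} (hw : w ∈ minimalReps) {word : List ℤ}
    (h : IsReducedWord w word) : StrictMono fun r => w (posIdx r) := by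
  refine strictMono_nat_of_lt_succ fun r => ?_
  have h1 : posIdx r = lo ((r : ℤ) + 1) := by
    refine Subtype.ext ?_
    unfold lo
    split_ifs <;> simp only [posIdx] <;> omega
  have h2 : posIdx (r + 1) = hi ((r : ℤ) + 1) := by
    refine Subtype.ext ?_
    unfold hi
    split_ifs <;> simp only [posIdx] <;> omega
  simp only [h1, h2]
  exact map_lo_lt_map_hi hw h (by omega)

theorem exists_bound_wordProd (word : List ℤ) :
    ∃ M : ℕ, ∀ x : NZInt, M ≤ x.1.natAbs → wordProd word x = x := by
  induction word with
  | nil => exact ⟨0, fun x _ => rfl⟩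
  | cons i l ih =>
    obtain ⟨M, hM⟩ := ih
    refine ⟨M + (lo i).1.natAbs + (hi i).1.natAbs + 1, fun x hx => ?_⟩
    rw [wordProd_cons, Equiv.Perm.mul_apply, hM x (by omega)]
    refine Equiv.swap_apply_of_ne_of_ne ?_ ?_ <;> rintro rfl <;> omega

/-! ### Words of charge zero -/

/-- Semi-infinite words which agree with the vacuum far to the left. -/
def Neutral (b : SemiInfWord) : Prop := ∃ R : ℕ, ∀ r, R ≤ r → b.letter r = negIdx r

/-- The semi-infinite word with given letters, agreeing with the vacuum far to the left. -/
def wordOfLetters (f : ℕ → NZInt) (hf : StrictAnti f) (R : ℕ) (h : ∀ r, R ≤ r → f r = negIdx r) :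
    SemiInfWord where
  letter := f
  strictAnti := hf
  eventually_shift := ⟨0, R, fun r hr => by rw [h r hr]; simp [negIdx]⟩

theorem exists_word_of_minimalReps {w : Equiv.Perm NZInt} (hw : w ∈ minimalReps)
    {word : List ℤ} (h : IsReducedWord w word) :
    ∃ b : SemiInfWord, Neutral b ∧ ∀ r, b.letter r = w (negIdx r) := by
  obtain ⟨M, hM⟩ := exists_bound_wordProd word
  rw [h.1] at hM
  have key : ∀ r, M ≤ r → w (negIdx r) = negIdx r := fun r hr =>
    hM _ (by simp only [negIdx]; omega)
  exact ⟨wordOfLetters _ (strictAnti_map_negIdx hw h) M key, ⟨M, key⟩, fun r => rfl⟩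

/-- Descending induction from the stable tail, since each step to the right raises the letter by at
least one. The vacuum is thus the least neutral word. -/
theorem Neutral.negIdx_le {b : SemiInfWord} (hb : Neutral b) (r : ℕ) :
    negIdx r ≤ b.letter r := by
  obtain ⟨R, hR⟩ := hb
  have key : ∀ k r, r + k = max r R → negIdx r ≤ b.letter r := by
    intro k
    induction k with
    | zero => intro r hr; exact (hR r (by omega)).ge
    | succ k ih =>
      intro r hr
      have h1 := ih (r + 1) (by omega)
      have h2 := b.strictAnti (Nat.lt_succ_self r)
      have h3 := lt_of_le_of_lt h1 h2
      have h0 := (b.letter r).2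
      rw [← Subtype.coe_lt_coe] at h3
      rw [← Subtype.coe_le_coe]
      simp only [negIdx] at h3 ⊢
      push_cast at h3
      omega
  exact key (max r R - r) r (by omega)

/-! ### Crystal operators on words -/

namespace SemiInfWord

theorem lower_eq_some {i : ℤ} {x y : SemiInfWord} : lower i x = some y ↔
    lo i ∈ x ∧ hi i ∉ x ∧
      ∀ r, y.letter r = if x.letter r = lo i then hi i else x.letter r := by
  unfold lower
  split_ifs with h
  · rw [Option.some_inj]
    refine ⟨fun e => ⟨h.1, h.2, fun r => by rw [← e]; rfl⟩, fun e => ?_⟩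
    ext1
    funext r
    exact (e.2.2 r).symm
  · simp only [false_iff]
    exact fun e => h ⟨e.1, e.2.1⟩

theorem lo_notMem_of_lower {i : ℤ} {x y : SemiInfWord} (h : lower i x = some y) : lo i ∉ y := by
  obtain ⟨-, -, h3⟩ := lower_eq_some.mp h
  rintro ⟨r, hr⟩
  rw [h3 r] at hr
  split_ifs at hr with h'
  · exact (lo_lt_hi i).ne' hr
  · exact h' hr

theorem le_of_lower {i : ℤ} {x y : SemiInfWord} (h : lower i x = some y) (r : ℕ) :
    x.letter r ≤ y.letter r := by
  obtain ⟨-, -, h3⟩ := lower_eq_some.mp h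
  rw [h3 r]
  split_ifs with h'
  · rw [h']; exact (lo_lt_hi i).le
  · exact le_rfl

theorem eventually_eq_of_lower {i : ℤ} {x y : SemiInfWord} (h : lower i x = some y) :
    ∃ R, ∀ r, R ≤ r → y.letter r = x.letter r := by
  obtain ⟨⟨r0, hr0⟩, -, h3⟩ := lower_eq_some.mp h
  refine ⟨r0 + 1, fun r hr => ?_⟩
  rw [h3 r, if_neg]
  intro e
  have := x.strictAnti.injective (e.trans hr0.symm)
  omega

theorem neutral_iff_of_lower {i : ℤ} {x y : SemiInfWord} (h : lower i x = some y) :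
    Neutral x ↔ Neutral y := by
  obtain ⟨R, hR⟩ := eventually_eq_of_lower h
  constructor <;> rintro ⟨S, hS⟩ <;> refine ⟨max R S, fun r hr => ?_⟩
  · rw [hR r (le_trans (le_max_left _ _) hr), hS r (le_trans (le_max_right _ _) hr)]
  · rw [← hR r (le_trans (le_max_left _ _) hr), hS r (le_trans (le_max_right _ _) hr)]

/-- This is ẽ_i: the letter `hi i` is turned back into `lo i`. -/
theorem exists_lower_eq_some {i : ℤ} {y : SemiInfWord} (h1 : hi i ∈ y) (h2 : lo i ∉ y) :
    ∃ x, lower i x = some y := by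
  obtain ⟨r0, hr0⟩ := h1
  have hne : ∀ r, y.letter r ≠ lo i := fun r e => h2 ⟨r, e⟩
  have hanti : StrictAnti fun r => if y.letter r = hi i then lo i else y.letter r := by
    intro r s hrs
    have hlt := y.strictAnti hrs
    dsimp only
    split_ifs with h1 h2 h2
    · rw [h1, h2] at hlt
      exact absurd hlt (lt_irrefl _)
    · exact (lo_lt_hi i).trans (h1 ▸ hlt)
    · exact lt_of_le_of_ne (le_lo_of_lt_hi i _ (h2 ▸ hlt)) (hne s)
    · exact hlt
  obtain ⟨c, R, hR⟩ := y.eventually_shift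
  have hr : ∀ r, max R (r0 + 1) ≤ r → y.letter r ≠ hi i := by
    intro r hr e
    have := y.strictAnti.injective (e.trans hr0.symm)
    omega
  refine ⟨⟨_, hanti, c, max R (r0 + 1), fun r hr' => ?_⟩, lower_eq_some.mpr ⟨⟨r0, ?_⟩, ?_, ?_⟩⟩
  · rw [if_neg (hr r hr')]
    exact hR r (le_trans (le_max_left _ _) hr')
  · exact if_pos hr0
  · rintro ⟨r, e⟩
    dsimp only at e
    split_ifs at e with h'
    · exact (lo_lt_hi i).ne e
    · exact h' e
  · intro r
    dsimp only
    by_cases h' : y.letter r = hi i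
    · simp [h']
    · simp [h', hne r]

theorem eps_cases (i : ℤ) (b : SemiInfWord) :
    (eps i b = 1 ∧ phi i b = 0 ∧ hi i ∈ b ∧ lo i ∉ b) ∨
    (eps i b = 0 ∧ phi i b = 1 ∧ lo i ∈ b ∧ hi i ∉ b) ∨
    (eps i b = 0 ∧ phi i b = 0 ∧ (lo i ∈ b ↔ hi i ∈ b)) := by
  unfold eps phi
  by_cases h1 : lo i ∈ b <;> by_cases h2 : hi i ∈ b <;> simp [h1, h2]

end SemiInfWord

open SemiInfWord

/-- The letterwise order on words. -/
def Dom (b b' : SemiInfWord) : Prop := ∀ r, b'.letter r ≤ b.letter r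

theorem Dom.trans {a b c : SemiInfWord} (h : Dom a b) (h' : Dom b c) : Dom a c :=
  fun r => (h' r).trans (h r)

instance : IsTrans SemiInfWord Dom := ⟨fun _ _ _ => Dom.trans⟩

/-- The bound can fail only where both words have the letter `lo i`. Then `phi i b = 0` puts `hi i`
into `b` at an earlier index, and there `x` is squeezed to `hi i` as well, so f̃_i could not act on
`x`. -/
theorem Dom.lower {i : ℤ} {b x y : SemiInfWord} (h : Dom b x) (hl : lower i x = some y)
    (hb : phi i b = 0) : Dom b y := by
  intro r
  obtain ⟨-, h2, h3⟩ := lower_eq_some.mp hl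
  rw [h3 r]
  split_ifs with hr
  · refine hi_le_of_lo_lt i _ (lt_of_le_of_ne (hr ▸ h r) fun e => ?_)
    rcases eps_cases i b with hc | hc | hc
    · exact hc.2.2.2 ⟨r, e.symm⟩
    · omega
    · obtain ⟨s, hs⟩ := hc.2.2.mp ⟨r, e.symm⟩
      have hsr : s < r := b.strictAnti.lt_iff_gt.mp (by rw [hs, ← e]; exact lo_lt_hi i)
      have h4 := x.strictAnti hsr
      rw [hr] at h4
      exact h2 ⟨s, le_antisymm (hs ▸ h s) (hi_le_of_lo_lt i _ h4)⟩
  · exact h r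

/-- Dual to `Dom.lower`: failure means that `y` has `hi i` where `b'` has `lo i`. Then `eps i y = 0`
puts `lo i` into `y` at a later index, forcing `lo i` into `b`, from which f̃_i has removed it. -/
theorem Dom.of_lower {i : ℤ} {b b' y : SemiInfWord} (h : Dom b y)
    (hl : SemiInfWord.lower i b' = some b) (hy : eps i y = 0) : Dom b' y := by
  intro r
  obtain ⟨-, h2, h3⟩ := lower_eq_some.mp hl
  have hbr := h3 r
  have hr := h r
  split_ifs at hbr with h'
  · rw [h']
    refine le_lo_of_lt_hi i _ (lt_of_le_of_ne (hbr ▸ hr) fun e => ?_)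
    rcases eps_cases i y with hc | hc | hc
    · omega
    · exact hc.2.2.2 ⟨r, e⟩
    · obtain ⟨s, hs⟩ := hc.2.2.mpr ⟨r, e⟩
      have hrs : r < s := y.strictAnti.lt_iff_gt.mp (by rw [hs, e]; exact lo_lt_hi i)
      have h4 := b.strictAnti hrs
      rw [hbr] at h4
      exact lo_notMem_of_lower hl ⟨s, le_antisymm (le_lo_of_lt_hi i _ h4) (hs ▸ h s)⟩
  · rwa [← hbr]

/-! ### Crystal operators on tensor products -/

theorem tensorEps_nonneg (i : ℤ) (bs : List SemiInfWord) : 0 ≤ tensorEps i bs := by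
  cases bs with
  | nil => exact le_rfl
  | cons b bs =>
    rw [tensorEps]
    rcases eps_cases i b with hc | hc | hc <;> simp [hc.1]

/-- The second conclusion is what the induction needs for a factor `b` that the tensor rule skips.
If f̃_i acts on the head `x`, the rule gives ε_i = 0 for the whole list, hence `phi i b = 0`, and
`Dom.lower` applies. -/
theorem isChain_of_tensorLower {i : ℤ} {bs bs' : List SemiInfWord}
    (h : tensorLower i bs = some bs') (hc : bs.IsChain Dom) :
    bs'.IsChain Dom ∧ ∀ b, (b :: bs).IsChain Dom → phi i b ≤ tensorEps i bs →
      (b :: bs').IsChain Dom := by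
  induction bs generalizing bs' with
  | nil => simp [tensorLower] at h
  | cons x xs ih =>
    rw [tensorLower] at h
    split_ifs at h with hx
    · obtain ⟨y, hy, rfl⟩ := Option.map_eq_some_iff.mp h
      have h1 : (y :: xs).IsChain Dom := by
        cases xs with
        | nil => exact List.isChain_singleton _
        | cons z zs =>
          rw [List.isChain_cons_cons] at hc ⊢
          exact ⟨fun r => (hc.1 r).trans (le_of_lower hy r), hc.2⟩
      refine ⟨h1, fun b hb hp => ?_⟩
      rw [List.isChain_cons_cons] at hb ⊢
      refine ⟨hb.1.lower hy ?_, h1⟩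
      have := tensorEps_nonneg i xs
      rw [tensorEps] at hp
      rcases eps_cases i x with hc | hc | hc <;> rcases eps_cases i b with hd | hd | hd <;>
        rw [hc.1, hc.2.1] at hp <;> omega
    · obtain ⟨ys, hy, rfl⟩ := Option.map_eq_some_iff.mp h
      have h1 := (ih hy hc.tail).2 x hc (not_lt.mp hx)
      refine ⟨h1, fun b hb _ => ?_⟩
      rw [List.isChain_cons_cons] at hb ⊢
      exact ⟨hb.1, h1⟩

/-- This is ẽ_i on chains. It passes the head `y` exactly when `phi i y < tensorEps i ys`; otherwise
it acts on `y`, and then ε_i vanishes on the next factor, as `Dom.of_lower` requires. -/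
theorem exists_tensorLower_of_tensorEps_pos {i : ℤ} {bs : List SemiInfWord}
    (h : 0 < tensorEps i bs) (hc : bs.IsChain Dom) :
    ∃ as, tensorLower i as = some bs ∧ tensorEps i as = tensorEps i bs - 1 ∧
      as.IsChain Dom ∧ ∀ b, (b :: bs).IsChain Dom → (b :: as).IsChain Dom := by
  induction bs with
  | nil => simp [tensorEps] at h
  | cons y ys ih =>
    rw [tensorEps] at h
    have h0 := tensorEps_nonneg i ys
    by_cases hy : phi i y < tensorEps i ys
    · obtain ⟨xs, h1, h2, -, h4⟩ := ih (by rcases eps_cases i y with hd | hd | hd <;> omega) hc.tail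
      refine ⟨y :: xs, ?_, ?_, h4 y hc, fun b hb => ?_⟩
      · rw [tensorLower, if_neg (by omega), h1]; rfl
      · rw [tensorEps, tensorEps]
        rcases eps_cases i y with hd | hd | hd <;> rw [hd.1, hd.2.1] at h ⊢ <;> omega
      · rw [List.isChain_cons_cons] at hb ⊢
        exact ⟨hb.1, h4 y hc⟩
    · rcases eps_cases i y with hd | hd | hd
      · obtain ⟨x, hx⟩ := exists_lower_eq_some hd.2.2.1 hd.2.2.2
        have hx' := lower_eq_some.mp hx
        have hpx : eps i x = 0 ∧ phi i x = 1 := by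
          rcases eps_cases i x with he | he | he
          · exact absurd he.2.2.1 hx'.2.1
          · exact ⟨he.1, he.2.1⟩
          · exact absurd (he.2.2.mp hx'.1) hx'.2.1
        have hchain : (x :: ys).IsChain Dom := by
          cases ys with
          | nil => exact List.isChain_singleton _
          | cons z zs =>
            rw [List.isChain_cons_cons] at hc ⊢
            refine ⟨hc.1.of_lower hx ?_, hc.2⟩
            rw [tensorEps] at hy h0
            rcases eps_cases i z with he | he | he <;> omega
        refine ⟨x :: ys, ?_, ?_, hchain, fun b hb => ?_⟩
        · rw [tensorLower, if_pos (by omega), hx]; rfl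
        · rw [tensorEps, tensorEps, hpx.1, hpx.2, hd.1, hd.2.1]; omega
        · rw [List.isChain_cons_cons] at hb ⊢
          exact ⟨fun r => (le_of_lower hx r).trans (hb.1 r), hchain⟩
      · omega
      · omega

theorem forall₂_of_tensorLower {i : ℤ} {bs bs' : List SemiInfWord}
    (h : tensorLower i bs = some bs') :
    List.Forall₂ (fun x y => x = y ∨ lower i x = some y) bs bs' := by
  induction bs generalizing bs' with
  | nil => simp [tensorLower] at h
  | cons x xs ih =>
    rw [tensorLower] at h
    split_ifs at h with hx
    · obtain ⟨y, hy, rfl⟩ := Option.map_eq_some_iff.mp h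
      exact .cons (Or.inr hy) (List.forall₂_same.mpr fun _ _ => Or.inl rfl)
    · obtain ⟨ys, hy, rfl⟩ := Option.map_eq_some_iff.mp h
      exact .cons (Or.inl rfl) (ih hy)

theorem forall_iff_of_tensorLower {i : ℤ} {p : SemiInfWord → Prop}
    (hp : ∀ x y, lower i x = some y → (p x ↔ p y)) {bs bs' : List SemiInfWord}
    (h : tensorLower i bs = some bs') : (∀ x ∈ bs, p x) ↔ ∀ x ∈ bs', p x := by
  have h2 := forall₂_of_tensorLower h
  clear h
  induction h2 with
  | nil => rfl
  | cons hxy _ ih =>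
    rw [List.forall_mem_cons, List.forall_mem_cons]
    rcases hxy with rfl | hxy
    · exact and_congr_right fun _ => ih
    · exact and_congr (hp _ _ hxy) ih

theorem length_of_tensorLower {i : ℤ} {bs bs' : List SemiInfWord}
    (h : tensorLower i bs = some bs') : bs.length = bs'.length :=
  (forall₂_of_tensorLower h).length_eq

/-! ### Demazure crystals -/

theorem iterate_bind_eq_some {α : Type*} (f : α → Option α) (y : α) (m : ℕ) (z : Option α) :
    (fun z : Option α => z.bind f)^[m] z = some y →
    ∃ x, z = some x ∧ Relation.ReflTransGen (fun a b => f a = some b) x y := by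
  induction m generalizing z with
  | zero => exact fun h => ⟨y, h, .refl⟩
  | succ m ih =>
    intro h
    rw [Function.iterate_succ_apply] at h
    obtain ⟨x, hx, hxy⟩ := ih _ h
    obtain ⟨a, ha, hax⟩ := Option.bind_eq_some_iff.mp hx
    exact ⟨a, ha, .head hax hxy⟩

theorem exists_iterate_bind_eq_some {α : Type*} (f : α → Option α) {x y : α}
    (h : Relation.ReflTransGen (fun a b => f a = some b) x y) :
    ∃ m, (fun z : Option α => z.bind f)^[m] (some x) = some y := by
  induction h with
  | refl => exact ⟨0, rfl⟩
  | tail _ h ih =>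
    obtain ⟨m, hm⟩ := ih
    exact ⟨m + 1, by rw [Function.iterate_succ_apply', hm]; exact h⟩

/-- Trades the exponent of the leading letter for reachability, so that an induction on the word
adds one colour at a time. -/
theorem mem_demazureCrystal_cons {n : ℕ} {i : ℤ} {rest : List ℤ} {y : List SemiInfWord} :
    y ∈ demazureCrystal n (i :: rest) ↔ ∃ x ∈ demazureCrystal n rest,
      Relation.ReflTransGen (fun a b => tensorLower i a = some b) x y := by
  constructor
  · rintro ⟨ms, h1, h2⟩
    obtain ⟨p, ms, rfl, rfl, h3⟩ := List.map_eq_cons_iff.mp h1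
    obtain ⟨x, hx, hxy⟩ := iterate_bind_eq_some _ _ _ _ h2
    exact ⟨x, ⟨ms, h3, hx⟩, hxy⟩
  · rintro ⟨x, ⟨ms, h1, h2⟩, hxy⟩
    obtain ⟨m, hm⟩ := exists_iterate_bind_eq_some _ hxy
    refine ⟨(i, m) :: ms, by simp [h1], ?_⟩
    change (fun z => z.bind (tensorLower i))^[m] (lowerMonomial ms _) = _
    rw [h2, hm]

theorem forall_mem_crystalLambda0 {n : ℕ} {word : List ℤ} {bs : List SemiInfWord}
    (h : bs ∈ demazureCrystal n word) : ∀ b ∈ bs, b ∈ crystalLambda0 := by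
  induction word generalizing bs with
  | nil =>
    obtain ⟨ms, h1, h2⟩ := h
    obtain rfl := List.map_eq_nil_iff.mp h1
    obtain rfl := Option.some_inj.mp h2
    intro b hb
    rw [List.eq_of_mem_replicate hb]
    exact .refl _
  | cons i rest ih =>
    obtain ⟨x, hx, hxy⟩ := mem_demazureCrystal_cons.mp h
    have h0 := ih hx
    clear h hx
    induction hxy with
    | refl => exact h0
    | tail _ h2 ih2 =>
      refine (forall_iff_of_tensorLower (fun x y hl => ?_) h2).mp ih2
      exact ⟨fun hx => .trans _ _ _ hx (.rel _ _ ⟨i, hl⟩),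
        fun hy => .trans _ _ _ hy (.symm _ _ (.rel _ _ ⟨i, hl⟩))⟩

/-- The chains of words of charge zero below a given word. -/
def chainsBelow (n : ℕ) (b : SemiInfWord) : Set (List SemiInfWord) :=
  {bs | bs.length = n ∧ (∀ x ∈ bs, Neutral x) ∧ (b :: bs).IsChain Dom}

/-- f̃_i respects the bound `b` because `phi i b = 0`. Conversely, ẽ_i is applied to a chain below
`b` until ε_i is zero, and then `Dom.of_lower` replaces `b` by `b'`. -/
theorem chainsBelow_lower {n : ℕ} {i : ℤ} {b b' : SemiInfWord} (hl : lower i b' = some b)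
    {y : List SemiInfWord} : y ∈ chainsBelow n b ↔ ∃ x ∈ chainsBelow n b',
      Relation.ReflTransGen (fun a b => tensorLower i a = some b) x y := by
  have hphi : phi i b = 0 := by
    rcases eps_cases i b with h | h | h
    · exact h.2.1
    · exact absurd h.2.2.1 (lo_notMem_of_lower hl)
    · exact h.2.1
  constructor
  · rintro ⟨h1, h2, h3⟩
    obtain ⟨k, hk⟩ := Int.eq_ofNat_of_zero_le (tensorEps_nonneg i y)
    induction k generalizing y with
    | zero =>
      refine ⟨y, ⟨h1, h2, ?_⟩, .refl⟩
      cases y with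
      | nil => exact List.isChain_singleton _
      | cons z zs =>
        rw [List.isChain_cons_cons] at h3 ⊢
        refine ⟨h3.1.of_lower hl ?_, h3.2⟩
        rw [tensorEps] at hk
        rcases eps_cases i z with he | he | he <;> omega
    | succ k ih =>
      obtain ⟨as, e1, e2, -, e4⟩ :=
        exists_tensorLower_of_tensorEps_pos (i := i) (bs := y) (by omega) h3.tail
      obtain ⟨x, hx, hxy⟩ := ih ((length_of_tensorLower e1).trans h1)
        ((forall_iff_of_tensorLower (fun _ _ => neutral_iff_of_lower) e1).mpr h2) (e4 b h3)
        (by omega)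
      exact ⟨x, hx, hxy.tail e1⟩
  · rintro ⟨x, ⟨h1, h2, h3⟩, hxy⟩
    induction hxy with
    | refl =>
      refine ⟨h1, h2, ?_⟩
      cases x with
      | nil => exact List.isChain_singleton _
      | cons z zs =>
        rw [List.isChain_cons_cons] at h3 ⊢
        exact ⟨fun r => (h3.1 r).trans (le_of_lower hl r), h3.2⟩
    | tail _ h ih =>
      refine ⟨(length_of_tensorLower h).symm.trans ih.1,
        (forall_iff_of_tensorLower (fun _ _ => neutral_iff_of_lower) h).mp ih.2.1, ?_⟩
      refine (isChain_of_tensorLower h ih.2.2.tail).2 b ih.2.2 ?_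
      rw [hphi]
      exact tensorEps_nonneg i _

/-- Let `v = wordProd rest`. As `v⁻¹ (lo i) < v⁻¹ (hi i)` and `w = s_i v` reverses the images of
this pair, the two preimages cannot have the same sign. So `lo i` comes from a negative index and
`hi i` from a positive one: `b'` contains the former letter only. -/
theorem lower_of_isReducedWord {w : Equiv.Perm NZInt} {i : ℤ} {rest : List ℤ}
    (hw : w ∈ minimalReps) (h : IsReducedWord w (i :: rest)) {b b' : SemiInfWord}
    (hb : ∀ r, b.letter r = w (negIdx r)) (hb' : ∀ r, b'.letter r = wordProd rest (negIdx r)) :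
    lower i b' = some b := by
  have hlt := inv_lo_lt_inv_hi h
  have hwe : w = simpleReflection i * wordProd rest := by rw [← h.1, wordProd_cons]
  have h1 : w ((wordProd rest)⁻¹ (lo i)) = hi i := by
    rw [hwe, Equiv.Perm.mul_apply, perm_apply_inv]
    exact Equiv.swap_apply_left _ _
  have h2 : w ((wordProd rest)⁻¹ (hi i)) = lo i := by
    rw [hwe, Equiv.Perm.mul_apply, perm_apply_inv]
    exact Equiv.swap_apply_right _ _
  have key : ∃ r s, (wordProd rest)⁻¹ (lo i) = negIdx r ∧ (wordProd rest)⁻¹ (hi i) = posIdx s := by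
    rcases exists_negIdx_or_posIdx ((wordProd rest)⁻¹ (lo i)) with ⟨r, hr⟩ | ⟨r, hr⟩ <;>
    rcases exists_negIdx_or_posIdx ((wordProd rest)⁻¹ (hi i)) with ⟨s, hs⟩ | ⟨s, hs⟩ <;>
    rw [hr, hs] at hlt <;> rw [hr] at h1 <;> rw [hs] at h2
    · have := strictAnti_map_negIdx hw h (negIdx_lt_negIdx.mp hlt)
      simp only [h1, h2] at this
      exact absurd (this.trans (lo_lt_hi i)) (lt_irrefl _)
    · exact ⟨r, s, hr, hs⟩
    · exact absurd (hlt.trans (negIdx_lt_posIdx s r)) (lt_irrefl _)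
    · have := strictMono_map_posIdx hw h (posIdx_lt_posIdx.mp hlt)
      simp only [h1, h2] at this
      exact absurd (this.trans (lo_lt_hi i)) (lt_irrefl _)
  obtain ⟨r, s, hr, hs⟩ := key
  have hhi : hi i ∉ b' := by
    rintro ⟨t, ht⟩
    rw [hb', ← Equiv.Perm.eq_inv_iff_eq, hs] at ht
    exact (negIdx_lt_posIdx t s).ne ht
  refine lower_eq_some.mpr ⟨⟨r, ?_⟩, hhi, fun t => ?_⟩
  · rw [hb', ← hr, perm_apply_inv]
  · rw [hb t, hwe, Equiv.Perm.mul_apply, ← hb' t]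
    split_ifs with h'
    · rw [h']
      exact Equiv.swap_apply_left _ _
    · exact Equiv.swap_apply_of_ne_of_ne h' fun e => hhi ⟨t, e⟩

/-- The Demazure crystal consists of the chains below the extremal word. -/
theorem demazureCrystal_eq_chainsBelow {w : Equiv.Perm NZInt} (hw : w ∈ minimalReps)
    {word : List ℤ} (h : IsReducedWord w word) {b : SemiInfWord}
    (hb : ∀ r, b.letter r = w (negIdx r)) (n : ℕ) :
    demazureCrystal n word = chainsBelow n b := by
  induction word generalizing w b with
  | nil =>
    obtain rfl : w = 1 := h.1.symm
    ext bs
    constructor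
    · rintro ⟨ms, h1, h2⟩
      obtain rfl := List.map_eq_nil_iff.mp h1
      obtain rfl := Option.some_inj.mp h2
      refine ⟨by simp [highestWeight], fun x hx => ?_, ?_⟩
      · rw [List.eq_of_mem_replicate hx]
        exact ⟨0, fun r _ => rfl⟩
      · have hbv : b = SemiInfWord.vacuum := by
          ext1; funext r; exact hb r
        rw [hbv, highestWeight, ← List.replicate_succ]
        exact List.isChain_replicate_of_rel _ fun r => le_rfl
    · rintro ⟨h1, h2, h3⟩
      refine ⟨[], rfl, ?_⟩
      change some (highestWeight n) = some bs
      rw [Option.some_inj, eq_comm, highestWeight, List.eq_replicate_iff]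
      refine ⟨h1, fun x hx => ?_⟩
      -- For `w = 1` every factor lies below the vacuum, which is also the least neutral word.
      have h4 := List.rel_of_pairwise_cons (List.isChain_iff_pairwise.mp h3) hx
      ext1
      funext r
      exact le_antisymm ((h4 r).trans (hb r).le) ((h2 x hx).negIdx_le r)
  | cons i rest ih =>
    obtain ⟨b', -, hb'⟩ := exists_word_of_minimalReps (minimalReps_tail hw h) h.tail
    ext y
    rw [mem_demazureCrystal_cons, chainsBelow_lower (lower_of_isReducedWord hw h hb hb'),
      ih (minimalReps_tail hw h) h.tail hb']

/-! ### Finite sets as columns -/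

/-- The number of elements of `A` greater than `k`. -/
def numGt (A : Finset ℕ) (k : ℕ) : ℕ := (A.filter (k < ·)).card

theorem numGt_succ (A : Finset ℕ) (k : ℕ) :
    numGt A k = numGt A (k + 1) + if k + 1 ∈ A then 1 else 0 := by
  unfold numGt
  split_ifs with h
  · rw [← Finset.card_insert_of_notMem (a := k + 1) (by simp)]
    congr 1
    ext m
    simp only [Finset.mem_filter, Finset.mem_insert]
    constructor
    · rintro ⟨h1, h2⟩
      rcases eq_or_lt_of_le (Nat.succ_le_of_lt h2) with e | e
      · exact Or.inl e.symm
      · exact Or.inr ⟨h1, e⟩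
    · rintro (rfl | ⟨h1, h2⟩)
      · exact ⟨h, by omega⟩
      · exact ⟨h1, by omega⟩
  · rw [add_zero]
    congr 1
    refine Finset.filter_congr fun m hm => ⟨fun h2 => ?_, fun h2 => by omega⟩
    exact lt_of_le_of_ne h2 fun e => h (e ▸ hm)

theorem numGt_congr {A B : Finset ℕ} (h : ∀ m, 1 ≤ m → (m ∈ A ↔ m ∈ B)) (k : ℕ) :
    numGt A k = numGt B k := by
  unfold numGt
  congr 1
  ext m
  simp only [Finset.mem_filter]
  constructor <;> rintro ⟨h1, h2⟩
  · exact ⟨(h m (by omega)).mp h1, h2⟩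
  · exact ⟨(h m (by omega)).mpr h1, h2⟩

theorem numGt_antitone (A : Finset ℕ) : Antitone (numGt A) :=
  antitone_nat_of_succ_le fun k => by rw [numGt_succ A k]; exact Nat.le_add_right _ _

theorem numGt_eq_zero {A : Finset ℕ} {k : ℕ} (h : A.sup id ≤ k) : numGt A k = 0 := by
  rw [numGt, Finset.card_eq_zero, Finset.filter_eq_empty_iff]
  intro m hm
  have : id m ≤ A.sup id := Finset.le_sup hm
  simp only [id] at this
  omega

theorem exists_numGt_le (A : Finset ℕ) (r : ℕ) : ∃ k, numGt A k ≤ r :=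
  ⟨_, (numGt_eq_zero le_rfl).trans_le (Nat.zero_le r)⟩

/-- The `(r+1)`-st largest positive element of `A`, or `0`. -/
def nthLargest (A : Finset ℕ) (r : ℕ) : ℕ := Nat.find (exists_numGt_le A r)

/-- The decreasing list of elements and the tail counts are conjugate to each other; comparisons of
entries and of counts are exchanged through this. -/
theorem lt_nthLargest {A : Finset ℕ} {r k : ℕ} : k < nthLargest A r ↔ r < numGt A k := by
  rw [nthLargest, Nat.lt_find_iff]
  exact ⟨fun h => not_le.mp (h k le_rfl),
    fun h m hm => not_le.mpr (h.trans_le (numGt_antitone A hm))⟩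

theorem eq_of_forall_nat_lt {a b : ℕ} (h : ∀ k, k < a ↔ k < b) : a = b :=
  eq_of_forall_lt_iff h

theorem nthLargest_le_iff {A B : Finset ℕ} :
    (∀ r, nthLargest A r ≤ nthLargest B r) ↔ ∀ k, numGt A k ≤ numGt B k := by
  constructor
  · intro h k
    by_contra hc
    have h1 := lt_nthLargest.mpr (not_le.mp hc)
    exact lt_irrefl _ (lt_nthLargest.mp (h1.trans_le (h _)))
  · intro h r
    by_contra hc
    have h1 := lt_nthLargest.mp (not_le.mp hc)
    exact lt_irrefl _ (lt_nthLargest.mpr (h1.trans_le (h _)))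

theorem nthLargest_eq_iff {A : Finset ℕ} {r m : ℕ} :
    nthLargest A r = m + 1 ↔ r = numGt A (m + 1) ∧ m + 1 ∈ A := by
  have h1 : m < nthLargest A r ↔ _ := lt_nthLargest
  have h2 : m + 1 < nthLargest A r ↔ _ := lt_nthLargest
  have h3 := numGt_succ A m
  split_ifs at h3 with h <;> simp only [h, and_true, and_false, iff_false] <;> omega

theorem exists_nthLargest_eq {A : Finset ℕ} {m : ℕ} (hm : 1 ≤ m) :
    (∃ r, r < numGt A 0 ∧ nthLargest A r = m) ↔ m ∈ A := by
  obtain ⟨m, rfl⟩ := Nat.exists_eq_add_of_le' hm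
  simp only [nthLargest_eq_iff]
  constructor
  · rintro ⟨r, -, -, h⟩
    exact h
  · intro h
    refine ⟨_, ?_, rfl, h⟩
    have h1 := numGt_succ A m
    have h2 := numGt_antitone A (Nat.zero_le m)
    rw [if_pos h] at h1
    omega

theorem nthLargest_strict {A : Finset ℕ} {r s : ℕ} (hrs : r < s) (hs : s < numGt A 0) :
    nthLargest A s < nthLargest A r := by
  have h0 := lt_nthLargest.mpr hs
  obtain ⟨m, hm⟩ := Nat.exists_eq_add_of_lt h0
  rw [zero_add] at hm
  rw [hm, lt_nthLargest, ← (nthLargest_eq_iff.mp hm).1]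
  exact hrs

/-- A strictly decreasing list is determined by its set of values: by injectivity, both it and
`nthLargest A` are conjugate to the same tail counts. -/
theorem nthLargest_of_entries {A : Finset ℕ} {e : ℕ → ℕ} {L : ℕ} (hpos : ∀ r, r < L → 1 ≤ e r)
    (hzero : ∀ r, L ≤ r → e r = 0) (hstrict : ∀ r s, r < s → s < L → e s < e r)
    (hA : ∀ m, 1 ≤ m → (m ∈ A ↔ ∃ r, r < L ∧ e r = m)) :
    (∀ r, nthLargest A r = e r) ∧ numGt A 0 = L := by
  have hanti : Antitone e := by
    refine antitone_nat_of_succ_le fun r => ?_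
    by_cases h : r + 1 < L
    · exact (hstrict r (r + 1) (Nat.lt_succ_self r) h).le
    · rw [hzero _ (not_lt.mp h)]; exact Nat.zero_le _
  have hinj : ∀ r, r < L → ∀ s, s < L → e r = e s → r = s := by
    intro r hr s hs h
    rcases lt_trichotomy r s with h1 | h1 | h1
    · exact absurd h (hstrict r s h1 hs).ne'
    · exact h1
    · exact absurd h (hstrict s r h1 hr).ne
  have key : ∀ k, numGt A k = ((Finset.range L).filter (fun r => k < e r)).card := by
    intro k
    rw [numGt, ← Finset.card_image_of_injOn (s := (Finset.range L).filter (k < e ·)) (f := e)]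
    · congr 1
      ext m
      simp only [Finset.mem_filter, Finset.mem_image, Finset.mem_range]
      constructor
      · rintro ⟨h1, h2⟩
        obtain ⟨r, hr, rfl⟩ := (hA m (by omega)).mp h1
        exact ⟨r, ⟨hr, h2⟩, rfl⟩
      · rintro ⟨r, ⟨hr, h2⟩, rfl⟩
        exact ⟨(hA _ (by omega)).mpr ⟨r, hr, rfl⟩, h2⟩
    · intro r hr s hs h
      simp only [Finset.coe_filter, Finset.mem_range, Set.mem_ofPred_eq] at hr hs
      exact hinj r hr.1 s hs.1 h
  have key2 : ∀ k r, r < numGt A k ↔ k < e r := by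
    intro k r
    rw [key k]
    constructor
    · intro h
      by_contra hc
      have : (Finset.range L).filter (fun s => k < e s) ⊆ Finset.range r := by
        intro s hs
        simp only [Finset.mem_filter, Finset.mem_range] at hs ⊢
        by_contra hsr
        exact hc (hs.2.trans_le (hanti (not_lt.mp hsr)))
      have := Finset.card_le_card this
      rw [Finset.card_range] at this
      omega
    · intro h
      have : Finset.range (r + 1) ⊆ (Finset.range L).filter (fun s => k < e s) := by
        intro s hs
        simp only [Finset.mem_filter, Finset.mem_range] at hs ⊢
        have h1 : k < e s := h.trans_le (hanti (by omega))
        refine ⟨?_, h1⟩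
        by_contra hc
        rw [hzero s (not_lt.mp hc)] at h1
        omega
      have := Finset.card_le_card this
      rw [Finset.card_range] at this
      omega
  refine ⟨fun r => eq_of_forall_nat_lt fun k => by rw [lt_nthLargest, key2],
    eq_of_forall_nat_lt fun r => ?_⟩
  rw [key2]
  constructor
  · intro h
    by_contra hc
    rw [hzero r (not_lt.mp hc)] at h
    omega
  · exact hpos r

/-! ### Letter counts of words -/

theorem exists_letter_lt (b : SemiInfWord) (x : ℤ) : ∃ r, (b.letter r : ℤ) < x := by
  obtain ⟨c, R, h⟩ := b.eventually_shift
  refine ⟨max R (c - x).toNat, ?_⟩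
  rw [h _ (le_max_left _ _)]
  have := le_max_right R (c - x).toNat
  omega

/-- The number of letters that are at least `x`. -/
def numGe (b : SemiInfWord) (x : ℤ) : ℕ := Nat.find (exists_letter_lt b x)

theorem lt_numGe {b : SemiInfWord} {x : ℤ} {r : ℕ} : r < numGe b x ↔ x ≤ (b.letter r : ℤ) := by
  rw [numGe, Nat.lt_find_iff]
  refine ⟨fun h => not_lt.mp (h r le_rfl), fun h m hm => not_lt.mpr (h.trans ?_)⟩
  exact b.strictAnti.antitone hm

theorem numGe_letter_add_one (b : SemiInfWord) (r : ℕ) : numGe b (b.letter r + 1) = r := by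
  refine eq_of_forall_nat_lt fun s => ?_
  rw [lt_numGe, Int.add_one_le_iff, Subtype.coe_lt_coe]
  exact b.strictAnti.lt_iff_gt

open Classical in
theorem numGe_succ (b : SemiInfWord) (x : ℤ) :
    numGe b x = numGe b (x + 1) + if ∃ r, (b.letter r : ℤ) = x then 1 else 0 := by
  split_ifs with h
  · obtain ⟨r, rfl⟩ := h
    rw [numGe_letter_add_one]
    refine eq_of_forall_nat_lt fun s => ?_
    rw [lt_numGe, Subtype.coe_le_coe, b.strictAnti.le_iff_ge, Nat.lt_succ_iff]
  · rw [add_zero]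
    refine eq_of_forall_nat_lt fun s => ?_
    rw [lt_numGe, lt_numGe, Int.add_one_le_iff]
    exact ⟨fun h1 => lt_of_le_of_ne h1 fun e => h ⟨s, e.symm⟩, le_of_lt⟩

theorem dom_iff_numGe {b b' : SemiInfWord} : Dom b b' ↔ ∀ x, numGe b' x ≤ numGe b x := by
  constructor
  · intro h x
    by_contra hc
    have h1 := lt_numGe.mp (not_le.mp hc)
    exact lt_irrefl _ (lt_numGe.mpr (h1.trans (h _)))
  · intro h r
    have h1 : r < numGe b' (b'.letter r) := lt_numGe.mpr le_rfl
    exact lt_numGe.mp (h1.trans_le (h _))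

/-- `P` consists of the positive letters of `b`, and `N` of the `m` such that `-m` is not a
letter. -/
def IsColumns (b : SemiInfWord) (P N : Finset ℕ) : Prop :=
  ∀ m, 1 ≤ m → (m ∈ N ↔ ¬ HasNeg b m) ∧ (m ∈ P ↔ HasPos b m)

open Classical in
theorem exists_isColumns {b : SemiInfWord} (hb : Neutral b) : ∃ P N, IsColumns b P N := by
  obtain ⟨R, hR⟩ := hb
  -- Positive letters are at most the first letter, and `-m` is the letter of index `m - 1` as soon
  -- as `m > R`.
  refine ⟨(Finset.range ((b.letter 0).1.natAbs + 1)).filter (HasPos b),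
    (Finset.range (R + 1)).filter (fun m => ¬ HasNeg b m), fun m hm => ⟨?_, ?_⟩⟩ <;>
    rw [Finset.mem_filter, Finset.mem_range] <;>
    refine ⟨fun h => h.2, fun h => ⟨?_, h⟩⟩
  · by_contra hc
    refine h ⟨m - 1, ?_⟩
    rw [hR _ (by omega)]
    simp only [negIdx]
    omega
  · obtain ⟨r, hr⟩ := h
    have h1 : (b.letter r : ℤ) ≤ b.letter 0 := b.strictAnti.antitone (Nat.zero_le r)
    omega

theorem IsColumns.numGt_pos {b : SemiInfWord} {P N : Finset ℕ} (h : IsColumns b P N) (k : ℕ) :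
    numGt P k = numGe b (k + 1) := by
  classical
  have key : ∀ j k, k + j = max k (P.sup id + (b.letter 0).1.natAbs) →
      numGt P k = numGe b (k + 1) := by
    intro j
    induction j with
    | zero =>
      intro k hk
      rw [numGt_eq_zero (by omega)]
      by_contra hc
      have h1 := lt_numGe.mp (Nat.pos_of_ne_zero (Ne.symm hc))
      omega
    | succ j ih =>
      intro k hk
      rw [numGt_succ, numGe_succ, ih (k + 1) (by omega)]
      have h1 := (h (k + 1) (by omega)).2
      unfold HasPos at h1
      push_cast at h1 ⊢
      simp only [h1]
  exact key (max k (P.sup id + (b.letter 0).1.natAbs) - k) k (by omega)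

/-- Neutrality gives equality for large `k`. In passing from `k + 1` to `k` both sides drop by one
if `-(k + 1)` is a letter, and neither changes if it is missing. -/
theorem IsColumns.numGt_neg {b : SemiInfWord} {P N : Finset ℕ} (h : IsColumns b P N)
    (hb : Neutral b) (k : ℕ) : numGt N k + k = numGe b (-k) := by
  classical
  obtain ⟨R, hR⟩ := id hb
  have key : ∀ j k, k + j = max k (N.sup id + R) → numGt N k + k = numGe b (-k) := by
    intro j
    induction j with
    | zero =>
      intro k hk
      rw [numGt_eq_zero (by omega), zero_add]
      refine eq_of_forall_nat_lt fun r => ?_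
      rw [lt_numGe]
      constructor
      · intro hr
        have h1 : ((negIdx r : NZInt) : ℤ) ≤ b.letter r := hb.negIdx_le r
        simp only [negIdx] at h1
        omega
      · intro hr
        by_contra hc
        rw [hR r (by omega)] at hr
        simp only [negIdx] at hr
        omega
    | succ j ih =>
      intro k hk
      have h1 := (h (k + 1) (by omega)).1
      have h2 := ih (k + 1) (by omega)
      have h3 := numGe_succ b (-((k + 1 : ℕ) : ℤ))
      rw [show -((k + 1 : ℕ) : ℤ) + 1 = -(k : ℤ) by push_cast; ring] at h3
      change _ = _ + if HasNeg b (k + 1) then 1 else 0 at h3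
      rw [numGt_succ]
      by_cases h4 : HasNeg b (k + 1)
      · rw [if_pos h4] at h3
        rw [if_neg (fun e => h1.mp e h4)]
        omega
      · rw [if_neg h4] at h3
        rw [if_pos (h1.mpr h4)]
        omega
  exact key (max k (N.sup id + R) - k) k (by omega)

theorem numGe_zero (b : SemiInfWord) : numGe b 0 = numGe b 1 := by
  have := numGe_succ b 0
  rwa [if_neg, add_zero] at this
  rintro ⟨r, hr⟩
  exact (b.letter r).2 hr

/-- Zero is not a letter, so the counts of letters `≥ 0` and `≥ 1` agree. This is why the two
tableaux have the same shape. -/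
theorem IsColumns.numGt_zero_eq {b : SemiInfWord} {P N : Finset ℕ} (h : IsColumns b P N)
    (hb : Neutral b) : numGt N 0 = numGt P 0 := by
  have h1 := h.numGt_neg hb 0
  have h2 := h.numGt_pos 0
  have h3 := numGe_zero b
  simp only [Nat.cast_zero, neg_zero, zero_add, add_zero] at h1 h2
  omega

theorem IsColumns.nthLargest_pos {b : SemiInfWord} {P N : Finset ℕ} (h : IsColumns b P N)
    (r : ℕ) : nthLargest P r = (b.letter r : ℤ).toNat := by
  refine eq_of_forall_nat_lt fun k => ?_
  rw [lt_nthLargest, h.numGt_pos, lt_numGe]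
  omega

/-- Thresholds `x > 0` see only the positive sets and `x ≤ 0` only the missing ones; the shift by
`k` is common to both words and cancels. -/
theorem IsColumns.dom_iff {b b' : SemiInfWord} {P N P' N' : Finset ℕ} (h : IsColumns b P N)
    (h' : IsColumns b' P' N') (hb : Neutral b) (hb' : Neutral b') :
    Dom b b' ↔ (∀ k, numGt N' k ≤ numGt N k) ∧ ∀ k, numGt P' k ≤ numGt P k := by
  rw [dom_iff_numGe]
  constructor
  · intro hd
    refine ⟨fun k => ?_, fun k => ?_⟩
    · have h1 := h.numGt_neg hb k
      have h2 := h'.numGt_neg hb' k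
      have h3 := hd (-k)
      omega
    · rw [h.numGt_pos, h'.numGt_pos]
      exact hd _
  · rintro ⟨h1, h2⟩ x
    rcases le_or_gt x 0 with hx | hx
    · obtain ⟨k, rfl⟩ := Int.exists_eq_neg_ofNat hx
      rw [← h.numGt_neg hb k, ← h'.numGt_neg hb' k]
      exact Nat.add_le_add_right (h1 k) k
    · obtain ⟨k, rfl⟩ := Int.eq_succ_of_zero_lt hx
      have := h2 k
      rw [h.numGt_pos, h'.numGt_pos] at this
      exact_mod_cast this

theorem IsColumns.word_unique {b b' : SemiInfWord} {P N : Finset ℕ} (h : IsColumns b P N)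
    (h' : IsColumns b' P N) (hb : Neutral b) (hb' : Neutral b') : b = b' := by
  ext1
  funext r
  exact le_antisymm ((h'.dom_iff h hb' hb).mpr ⟨fun _ => le_rfl, fun _ => le_rfl⟩ r)
    ((h.dom_iff h' hb hb').mpr ⟨fun _ => le_rfl, fun _ => le_rfl⟩ r)

/-- The word lists `P` downwards, followed by the negatives of the positive integers outside `N`.
Equality of the two sizes makes its tail coincide with that of the vacuum. -/
theorem exists_word_of_columns {P N : Finset ℕ} (hPN : numGt N 0 = numGt P 0) :
    ∃ b, Neutral b ∧ IsColumns b P N := by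
  classical
  set d := numGt P 0 with hd
  let p : ℕ → Prop := fun m => 1 ≤ m ∧ m ∉ N
  have hinf : (Set.ofPred p).Infinite := by
    have := (Set.Ici_infinite 1).sdiff N.finite_toSet
    exact this
  -- Positive integers up to `k` outside `N` number `k` minus the elements of `N` in that range;
  -- beyond `N` this makes index `r` carry `-(r + 1)`.
  have hcount : ∀ k, Nat.count p (k + 1) + d = k + numGt N k := by
    intro k
    induction k with
    | zero =>
      have : ¬ p 0 := fun h => absurd h.1 (by omega)
      rw [Nat.count_succ, if_neg this, Nat.count_zero, hPN]
    | succ k ih =>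
      have h1 := numGt_succ N k
      rw [Nat.count_succ]
      by_cases h : k + 1 ∈ N
      · rw [if_neg (fun e : p (k + 1) => e.2 h)]
        rw [if_pos h] at h1
        omega
      · rw [if_pos (⟨by omega, h⟩ : p (k + 1))]
        rw [if_neg h] at h1
        omega
  have hp : ∀ j, p (Nat.nth p j) := fun j => Nat.nth_mem_of_infinite hinf j
  have hpos : ∀ r, r < d ↔ 0 < nthLargest P r := fun r => lt_nthLargest.symm
  let f : ℕ → ℤ := fun r => if r < d then (nthLargest P r : ℤ) else -(Nat.nth p (r - d) : ℤ)
  have hf1 : ∀ r, r < d → f r = nthLargest P r := fun r h => if_pos h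
  have hf2 : ∀ r, d ≤ r → f r = -(Nat.nth p (r - d) : ℤ) := fun r h => if_neg (not_lt.mpr h)
  have hf0 : ∀ r, f r ≠ 0 := by
    intro r
    rcases lt_or_ge r d with h | h
    · rw [hf1 r h]
      have := (hpos r).mp h
      omega
    · rw [hf2 r h]
      have := (hp (r - d)).1
      omega
  have hanti : StrictAnti f := by
    intro r s hrs
    rcases lt_or_ge s d with h | h
    · rw [hf1 s h, hf1 r (hrs.trans h)]
      exact_mod_cast nthLargest_strict hrs h
    · rcases lt_or_ge r d with h' | h'
      · rw [hf2 s h, hf1 r h']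
        have := (hp (s - d)).1
        omega
      · rw [hf2 s h, hf2 r h']
        have := Nat.nth_strictMono hinf (show r - d < s - d by omega)
        omega
  have hev : ∀ r, N.sup id ≤ r → f r = -((r : ℤ) + 1) := by
    intro r hr
    have h1 := hcount r
    rw [numGt_eq_zero hr] at h1
    have h2 : p (r + 1) := by
      refine ⟨by omega, fun h => ?_⟩
      have : id (r + 1) ≤ N.sup id := Finset.le_sup h
      simp only [id] at this
      omega
    rw [hf2 r (by omega), show r - d = Nat.count p (r + 1) by omega, Nat.nth_count h2]
    push_cast
    ring
  let b : SemiInfWord := wordOfLetters (fun r => ⟨f r, hf0 r⟩) hanti (N.sup id)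
    fun r hr => Subtype.ext (hev r hr)
  have hbf : ∀ r, (b.letter r : ℤ) = f r := fun r => rfl
  refine ⟨b, ⟨N.sup id, fun r hr => Subtype.ext (hev r hr)⟩, fun m hm => ⟨?_, ?_⟩⟩
  · rw [iff_not_comm]
    constructor
    · rintro ⟨r, hr⟩
      rw [hbf] at hr
      rcases lt_or_ge r d with h | h
      · rw [hf1 r h] at hr
        omega
      · rw [hf2 r h] at hr
        have := hp (r - d)
        rw [show Nat.nth p (r - d) = m by omega] at this
        exact this.2
    · intro h
      have h2 : p m := ⟨hm, h⟩
      refine ⟨d + Nat.count p m, ?_⟩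
      rw [hbf, hf2 _ (by omega), Nat.add_sub_cancel_left, Nat.nth_count h2]
  · rw [← exists_nthLargest_eq hm]
    constructor
    · rintro ⟨r, h, hr⟩
      exact ⟨r, by rw [hbf, hf1 r h, hr]⟩
    · rintro ⟨r, hr⟩
      rw [hbf] at hr
      rcases lt_or_ge r d with h | h
      · rw [hf1 r h] at hr
        exact ⟨r, h, by exact_mod_cast hr⟩
      · rw [hf2 r h] at hr
        omega

/-! ### Frobenius coordinates -/

theorem ncard_setOf_lt (k : ℕ) : Set.ncard {r : ℕ | r < k} = k := by
  rw [show {r : ℕ | r < k} = (Finset.range k : Set ℕ) by ext; simp, Set.ncard_coe_finset,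
    Finset.card_range]

theorem IsColumns.numGe_dual {b b' : SemiInfWord} {P N : Finset ℕ} (h : IsColumns b P N)
    (h' : IsColumns b' N P) (hb : Neutral b) (k : ℕ) :
    numGe b (-k) = numGe b' (k + 1) + k := by
  rw [← h.numGt_neg hb k, h'.numGt_pos k]

/-- The word of an element of `W^{Λ_0}` encodes the Frobenius coordinates of its shape. -/
theorem exists_word_frobenius {w : Equiv.Perm NZInt} (hw : w ∈ minimalReps)
    {word : List ℤ} (hword : IsReducedWord w word) :
    ∃ b P N, Neutral b ∧ IsColumns b P N ∧ (∀ r, b.letter r = w (negIdx r)) ∧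
      diagLength w = numGt P 0 ∧
      (∀ r, r < diagLength w → frobLower w r = nthLargest N r) ∧
      ∀ r, r < diagLength w → frobUpper w r = nthLargest P r := by
  obtain ⟨b, hb, hbw⟩ := exists_word_of_minimalReps hw hword
  obtain ⟨P, N, hcol⟩ := exists_isColumns hb
  have hmono := strictMono_map_posIdx hw hword
  have hanti := strictAnti_map_negIdx hw hword
  -- The dual word: the images of the positive integers, negated. Since `w` is a bijection, it
  -- exchanges the roles of `P` and `N`.
  obtain ⟨b', hb', hbw'⟩ : ∃ b', Neutral b' ∧
      ∀ r, (b'.letter r : ℤ) = -(w (posIdx r) : ℤ) := by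
    obtain ⟨M, hM⟩ := exists_bound_wordProd word
    rw [hword.1] at hM
    have key : ∀ r, M ≤ r → (⟨-(w (posIdx r) : ℤ), neg_ne_zero.mpr (w (posIdx r)).2⟩ : NZInt)
        = negIdx r := fun r hr => by
      rw [Subtype.mk.injEq, hM _ (by simp only [posIdx]; omega)]
      rfl
    exact ⟨wordOfLetters (fun r => ⟨-(w (posIdx r) : ℤ), neg_ne_zero.mpr (w (posIdx r)).2⟩)
      (fun r s h => neg_lt_neg (Subtype.coe_lt_coe.mpr (hmono h))) M key, ⟨M, key⟩, fun r => rfl⟩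
  have hcol' : IsColumns b' N P := by
    intro m hm
    have h := hcol m hm
    rw [h.1, h.2, HasPos, HasNeg, HasNeg, HasPos]
    simp only [hbw, hbw']
    have hneg : ∀ r s, w (negIdx r) ≠ w (posIdx s) := fun r s e =>
      (negIdx_lt_posIdx r s).ne (w.injective e)
    have hsurj : ∀ x : NZInt, (∃ r, w (negIdx r) = x) ∨ ∃ r, w (posIdx r) = x := fun x => by
      rcases exists_negIdx_or_posIdx (w⁻¹ x) with ⟨r, hr⟩ | ⟨r, hr⟩
      · exact Or.inl ⟨r, by rw [← hr, perm_apply_inv]⟩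
      · exact Or.inr ⟨r, by rw [← hr, perm_apply_inv]⟩
    constructor
    · constructor
      · rintro ⟨r, hr⟩ ⟨s, hs⟩
        exact hneg r s (Subtype.ext (by omega))
      · intro hs
        rcases hsurj ⟨(m : ℤ), by omega⟩ with ⟨r, hr⟩ | ⟨r, hr⟩
        · exact ⟨r, by rw [hr]⟩
        · exact absurd ⟨r, by rw [hr]⟩ hs
    · constructor
      · intro hs
        rcases hsurj ⟨-(m : ℤ), by omega⟩ with ⟨r, hr⟩ | ⟨r, hr⟩
        · exact absurd ⟨r, by rw [hr]⟩ hs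
        · exact ⟨r, by rw [hr]; simp⟩
      · rintro ⟨r, hr⟩ ⟨s, hs⟩
        exact hneg s r (Subtype.ext (by omega))
  -- As `w` is increasing on negatives, the boxes of row `r` come from positive indices `s` with `w
  -- (posIdx s) < w (negIdx r)`, an initial segment counted by `b'`.
  have hrow : ∀ r, shapeRow w r = numGe b' (-(b.letter r : ℤ)) := by
    intro r
    have hset : {j : NZInt | (negIdx r, j) ∈ diagram w} =
        (fun s => w (posIdx s)) '' {s : ℕ | s < numGe b' (-(b.letter r : ℤ))} := by
      ext j
      simp only [diagram, Set.mem_ofPred_eq, Set.mem_image, lt_numGe, hbw', hbw, neg_le_neg_iff,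
        Subtype.coe_le_coe]
      constructor
      · rintro ⟨h1, h2⟩
        rcases exists_negIdx_or_posIdx (w⁻¹ j) with ⟨s, hs⟩ | ⟨s, hs⟩
        · rw [hs] at h1
          have h3 := hanti (negIdx_lt_negIdx.mp h1)
          simp only [← hs, perm_apply_inv] at h3
          exact absurd (h2.trans h3) (lt_irrefl _)
        · exact ⟨s, by rw [← hs, perm_apply_inv]; exact h2.le, by rw [← hs, perm_apply_inv]⟩
      · rintro ⟨s, hs, rfl⟩
        rw [perm_inv_apply]
        exact ⟨negIdx_lt_posIdx r s,
          lt_of_le_of_ne hs fun e => (negIdx_lt_posIdx r s).ne' (w.injective e)⟩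
    rw [shapeRow, hset, Set.ncard_image_of_injective _ hmono.injective, ncard_setOf_lt]
  have hcolumn : ∀ c, shapeCol w c = numGe b (-(b'.letter c : ℤ)) := by
    intro c
    rw [shapeCol, show {r : ℕ | c < shapeRow w r} =
      {r : ℕ | r < numGe b (-(b'.letter c : ℤ))} by
        ext r
        simp only [Set.mem_ofPred_eq, hrow, lt_numGe]
        omega, ncard_setOf_lt]
  -- By duality a row with positive letter exceeds its index by exactly that letter, which is
  -- therefore a Frobenius coordinate; by `hrow_neg` rows with negative letter miss the diagonal.
  have hrow_pos : ∀ r, 0 < (b.letter r : ℤ) → shapeRow w r = r + (b.letter r : ℤ).toNat := by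
    intro r hr
    have h1 := hcol'.numGe_dual hcol hb' (b.letter r : ℤ).toNat
    rw [Int.toNat_of_nonneg hr.le, numGe_letter_add_one] at h1
    rw [hrow, h1]
  have hcol_pos : ∀ r, 0 < (b'.letter r : ℤ) → shapeCol w r = r + (b'.letter r : ℤ).toNat := by
    intro r hr
    have h1 := hcol.numGe_dual hcol' hb (b'.letter r : ℤ).toNat
    rw [Int.toNat_of_nonneg hr.le, numGe_letter_add_one] at h1
    rw [hcolumn, h1]
  have hrow_neg : ∀ r, (b.letter r : ℤ) < 0 → shapeRow w r ≤ r := by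
    intro r hr
    have h1 := hcol.numGe_dual hcol' hb (-(b.letter r : ℤ) - 1).toNat
    rw [Int.toNat_of_nonneg (by omega), neg_sub, sub_neg_eq_add, add_comm 1,
      numGe_letter_add_one, sub_add_cancel] at h1
    rw [hrow]
    omega
  have hdiag : diagLength w = numGt P 0 := by
    rw [diagLength, show {r : ℕ | r < shapeRow w r} = {r : ℕ | r < numGt P 0} by
      ext r
      simp only [Set.mem_ofPred_eq]
      rw [hcol.numGt_pos, lt_numGe]
      rcases lt_or_gt_of_ne (b.letter r).2 with h | h
      · have := hrow_neg r h
        omega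
      · have := hrow_pos r h
        omega, ncard_setOf_lt]
  refine ⟨b, P, N, hb, hcol, hbw, hdiag, fun r hr => ?_, fun r hr => ?_⟩
  · rw [hdiag, ← hcol.numGt_zero_eq hb, hcol'.numGt_pos, lt_numGe] at hr
    rw [frobLower, hcol_pos r (by omega), hcol'.nthLargest_pos, Nat.add_sub_cancel_left]
  · rw [hdiag, hcol.numGt_pos, lt_numGe] at hr
    rw [frobUpper, hrow_pos r (by omega), hcol.nthLargest_pos, Nat.add_sub_cancel_left]

/-! ### Tableaux and their columns -/

/-- The Young diagram with prescribed column lengths. -/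
def diagramOfHeights (h : ℕ → ℕ) (hanti : Antitone h) (n : ℕ) (hn : ∀ c, n ≤ c → h c = 0) :
    YoungDiagram where
  cells := ((Finset.range (h 0)) ×ˢ Finset.range n).filter (fun p => p.1 < h p.2)
  isLowerSet := by
    rintro ⟨a, b⟩ ⟨a', b'⟩ hle hm
    obtain ⟨h1, h2⟩ := Prod.mk_le_mk.mp hle
    simp only [Finset.coe_filter, Finset.mem_product, Finset.mem_range, Set.mem_ofPred_eq] at hm ⊢
    have := hanti h2
    omega

theorem mem_diagramOfHeights {h : ℕ → ℕ} {hanti : Antitone h} {n : ℕ}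
    {hn : ∀ c, n ≤ c → h c = 0} {r c : ℕ} :
    (r, c) ∈ diagramOfHeights h hanti n hn ↔ r < h c := by
  rw [← YoungDiagram.mem_cells]
  simp only [diagramOfHeights, Finset.mem_filter, Finset.mem_product, Finset.mem_range]
  refine ⟨fun h => h.2, fun hr => ⟨⟨hr.trans_le (hanti (Nat.zero_le c)), ?_⟩, hr⟩⟩
  by_contra hc
  rw [hn c (not_lt.mp hc)] at hr
  omega

theorem mem_rectDiagram {n d r c : ℕ} : (r, c) ∈ rectDiagram n d ↔ r < d ∧ c < n := by
  rw [← YoungDiagram.mem_cells]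
  simp [rectDiagram]

/-- The tableau whose columns consist of the positive elements of given finite sets. -/
def tableauOfColumns (ν : YoungDiagram) (A : ℕ → Finset ℕ)
    (hA : ∀ r c, (r, c) ∈ ν ↔ r < numGt (A c) 0)
    (hmono : ∀ c c', c < c' → ∀ k, numGt (A c') k ≤ numGt (A c) k) : AntiNormalSST ν where
  entry r c := nthLargest (A c) r
  entry_pos r c h := lt_nthLargest.mpr ((hA r c).mp h)
  entry_zero r c h := by
    by_contra hc
    exact h ((hA r c).mpr (lt_nthLargest.mp (Nat.pos_of_ne_zero hc)))
  row_weak r c c' h _ := nthLargest_le_iff.mpr (hmono c c' h) r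
  col_strict r r' c h hm := nthLargest_strict h ((hA r' c).mp hm)

/-- The set of entries of a column. -/
def AntiNormalSST.column {ν : YoungDiagram} (T : AntiNormalSST ν) (c : ℕ) : Finset ℕ :=
  (Finset.range (ν.colLen c)).image fun r => T.entry r c

theorem AntiNormalSST.mem_column {ν : YoungDiagram} (T : AntiNormalSST ν) {c m : ℕ} :
    m ∈ T.column c ↔ ∃ r, (r, c) ∈ ν ∧ T.entry r c = m := by
  simp [AntiNormalSST.column, YoungDiagram.mem_iff_lt_colLen]

theorem AntiNormalSST.nthLargest_column {ν : YoungDiagram} (T : AntiNormalSST ν) (c : ℕ) :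
    (∀ r, nthLargest (T.column c) r = T.entry r c) ∧ numGt (T.column c) 0 = ν.colLen c := by
  refine nthLargest_of_entries (fun r hr => T.entry_pos r c (YoungDiagram.mem_iff_lt_colLen.mpr hr))
    (fun r hr => T.entry_zero r c fun h => ?_)
    (fun r s hrs hs => T.col_strict r s c hrs (YoungDiagram.mem_iff_lt_colLen.mpr hs))
    (fun m _ => ?_)
  · exact absurd (YoungDiagram.mem_iff_lt_colLen.mp h) (not_lt.mpr hr)
  · rw [T.mem_column]
    simp only [YoungDiagram.mem_iff_lt_colLen]

theorem AntiNormalSST.numGt_column_le {ν : YoungDiagram} (T : AntiNormalSST ν) {c c' : ℕ}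
    (h : c < c') : ∀ k, numGt (T.column c') k ≤ numGt (T.column c) k := by
  rw [← nthLargest_le_iff]
  intro r
  rw [(T.nthLargest_column c).1, (T.nthLargest_column c').1]
  by_cases hm : (r, c') ∈ ν
  · exact T.row_weak r c c' h hm
  · rw [T.entry_zero r c' hm]
    exact Nat.zero_le _

theorem AntiNormalSST.entry_pos_iff {ν : YoungDiagram} (T : AntiNormalSST ν) (r c : ℕ) :
    0 < T.entry r c ↔ (r, c) ∈ ν := by
  refine ⟨fun h => ?_, T.entry_pos r c⟩
  by_contra hc
  rw [T.entry_zero r c hc] at h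
  exact lt_irrefl _ h

theorem isBitableauOf_iff {ν : YoungDiagram} {bs : List SemiInfWord} {S T : AntiNormalSST ν} :
    IsBitableauOf bs S T ↔
      ∀ k (hk : k < bs.length), IsColumns bs[k] (T.column k) (S.column k) := by
  simp only [IsBitableauOf, IsColumns, AntiNormalSST.mem_column]

theorem AntiNormalSST.entry_eq_of_columns {ν ν' : YoungDiagram} {n d : ℕ}
    (hν : ν ≤ rectDiagram n d) (hν' : ν' ≤ rectDiagram n d) {T : AntiNormalSST ν}
    {T' : AntiNormalSST ν'}
    (h : ∀ c, c < n → ∀ m, 1 ≤ m → (m ∈ T.column c ↔ m ∈ T'.column c)) :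
    T.entry = T'.entry := by
  funext r c
  by_cases hc : c < n
  · rw [← (T.nthLargest_column c).1, ← (T'.nthLargest_column c).1]
    refine eq_of_forall_nat_lt fun k => ?_
    rw [lt_nthLargest, lt_nthLargest, numGt_congr (h c hc)]
  · rw [T.entry_zero r c fun hm => hc (mem_rectDiagram.mp (hν hm)).2,
      T'.entry_zero r c fun hm => hc (mem_rectDiagram.mp (hν' hm)).2]

/-- The columns determine the entries, and the shape is the support of the entries. -/
theorem FlaggedBitableaux.eq_of_isBitableauOf {n d : ℕ} {f g : ℕ → ℕ}
    {t t' : FlaggedBitableaux n d f g} {bs : List SemiInfWord} (hlen : bs.length = n)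
    (h : IsBitableauOf bs t.2.1.1 t.2.2.1) (h' : IsBitableauOf bs t'.2.1.1 t'.2.2.1) :
    t = t' := by
  obtain ⟨⟨ν, hν⟩, ⟨S, hS⟩, ⟨T, hT⟩⟩ := t
  obtain ⟨⟨ν', hν'⟩, ⟨S', hS'⟩, ⟨T', hT'⟩⟩ := t'
  rw [isBitableauOf_iff] at h h'
  dsimp only at h h'
  have e1 : S.entry = S'.entry := AntiNormalSST.entry_eq_of_columns hν hν' fun c hc m hm =>
    (h c (hlen ▸ hc) m hm).1.trans (h' c (hlen ▸ hc) m hm).1.symm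
  have e2 : T.entry = T'.entry := AntiNormalSST.entry_eq_of_columns hν hν' fun c hc m hm =>
    (h c (hlen ▸ hc) m hm).2.trans (h' c (hlen ▸ hc) m hm).2.symm
  have e3 : ν = ν' := by
    ext ⟨r, c⟩
    rw [YoungDiagram.mem_cells, YoungDiagram.mem_cells, ← S.entry_pos_iff, ← S'.entry_pos_iff, e1]
  subst e3
  obtain rfl : S = S' := AntiNormalSST.ext e1
  obtain rfl : T = T' := AntiNormalSST.ext e2
  rfl

theorem eq_of_isBitableauOf {ν : YoungDiagram} {S T : AntiNormalSST ν} {bs bs' : List SemiInfWord}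
    (hlen : bs.length = bs'.length) (hn : ∀ x ∈ bs, Neutral x) (hn' : ∀ x ∈ bs', Neutral x)
    (h : IsBitableauOf bs S T) (h' : IsBitableauOf bs' S T) : bs = bs' := by
  rw [isBitableauOf_iff] at h h'
  exact List.ext_getElem hlen fun k hk hk' => (h k hk).word_unique (h' k hk')
    (hn _ (List.getElem_mem hk)) (hn' _ (List.getElem_mem hk'))

/-! ### Chains below a word and flagged pairs of tableaux -/

section Correspondence

variable {n d : ℕ} {f g : ℕ → ℕ} {b : SemiInfWord} {P N : Finset ℕ}

theorem exists_flaggedBitableaux (hb : Neutral b) (hcol : IsColumns b P N) (hd : d = numGt P 0)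
    (hf : ∀ r, r < d → f (d - 1 - r) = nthLargest N r)
    (hg : ∀ r, r < d → g (d - 1 - r) = nthLargest P r)
    {bs : List SemiInfWord} (hbs : bs ∈ chainsBelow n b) :
    ∃ t : FlaggedBitableaux n d f g, IsBitableauOf bs t.2.1.1 t.2.2.1 := by
  obtain ⟨hlen, hneut, hchain⟩ := hbs
  have hpair := List.pairwise_cons.mp (List.isChain_iff_pairwise.mp hchain)
  -- Columns from index `n` on are taken empty, so that the shape has at most `n` columns.
  have hex : ∀ k, ∃ A B : Finset ℕ, (∀ hk : k < bs.length, IsColumns bs[k] A B) ∧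
      (n ≤ k → A = ∅ ∧ B = ∅) := by
    intro k
    by_cases hk : k < bs.length
    · obtain ⟨A, B, h⟩ := exists_isColumns (hneut _ (List.getElem_mem hk))
      exact ⟨A, B, fun _ => h, fun h => by omega⟩
    · exact ⟨∅, ∅, fun h => absurd h hk, fun _ => ⟨rfl, rfl⟩⟩
  choose A B hAB hempty using hex
  have hzero : ∀ c, n ≤ c → ∀ k, numGt (A c) k = 0 ∧ numGt (B c) k = 0 := by
    intro c hc k
    rw [(hempty c hc).1, (hempty c hc).2]
    exact ⟨rfl, rfl⟩
  have hle : ∀ c c', c < c' →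
      (∀ k, numGt (B c') k ≤ numGt (B c) k) ∧ ∀ k, numGt (A c') k ≤ numGt (A c) k := by
    intro c c' hcc
    by_cases hc : c' < n
    · have h1 : c < bs.length := by omega
      have h2 : c' < bs.length := by omega
      exact ((hAB c h1).dom_iff (hAB c' h2) (hneut _ (List.getElem_mem h1))
        (hneut _ (List.getElem_mem h2))).mp (List.pairwise_iff_getElem.mp hpair.2 c c' h1 h2 hcc)
    · refine ⟨fun k => ?_, fun k => ?_⟩
      · rw [(hzero c' (not_lt.mp hc) k).2]; exact Nat.zero_le _
      · rw [(hzero c' (not_lt.mp hc) k).1]; exact Nat.zero_le _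
  -- Comparison with `b` gives the flag conditions, and at `k = 0` the bound `d` on the column
  -- heights.
  have hbase : ∀ c, (∀ k, numGt (B c) k ≤ numGt N k) ∧ ∀ k, numGt (A c) k ≤ numGt P k := by
    intro c
    by_cases hc : c < n
    · have h1 : c < bs.length := by omega
      exact (hcol.dom_iff (hAB c h1) hb (hneut _ (List.getElem_mem h1))).mp
        (hpair.1 _ (List.getElem_mem h1))
    · refine ⟨fun k => ?_, fun k => ?_⟩
      · rw [(hzero c (not_lt.mp hc) k).2]; exact Nat.zero_le _
      · rw [(hzero c (not_lt.mp hc) k).1]; exact Nat.zero_le _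
  have hheight : ∀ c, numGt (B c) 0 = numGt (A c) 0 := by
    intro c
    by_cases hc : c < n
    · have h1 : c < bs.length := by omega
      exact (hAB c h1).numGt_zero_eq (hneut _ (List.getElem_mem h1))
    · rw [(hzero c (not_lt.mp hc) 0).1, (hzero c (not_lt.mp hc) 0).2]
  let ν : YoungDiagram := diagramOfHeights (fun c => numGt (A c) 0)
    (antitone_nat_of_succ_le fun c => (hle c (c + 1) (Nat.lt_succ_self c)).2 0) n
    fun c hc => (hzero c hc 0).1
  have hA : ∀ r c, (r, c) ∈ ν ↔ r < numGt (A c) 0 := fun r c => mem_diagramOfHeights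
  have hB : ∀ r c, (r, c) ∈ ν ↔ r < numGt (B c) 0 := fun r c => by rw [hheight, hA]
  have hν : ν ≤ rectDiagram n d := by
    rintro ⟨r, c⟩ hm
    have h1 := (hA r c).mp hm
    refine mem_rectDiagram.mpr ⟨h1.trans_le (((hbase c).2 0).trans hd.ge), ?_⟩
    by_contra hc
    rw [(hzero c (not_lt.mp hc) 0).1] at h1
    omega
  have hlt : ∀ r c, (r, c) ∈ ν → r < d := fun r c h => (mem_rectDiagram.mp (hν h)).1
  refine ⟨⟨⟨ν, hν⟩, ⟨tableauOfColumns ν B hB fun c c' h => (hle c c' h).1, fun r c h => ?_⟩,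
    ⟨tableauOfColumns ν A hA fun c c' h => (hle c c' h).2, fun r c h => ?_⟩⟩, ?_⟩
  · rw [hf r (hlt r c h)]
    exact nthLargest_le_iff.mpr (hbase c).1 r
  · rw [hg r (hlt r c h)]
    exact nthLargest_le_iff.mpr (hbase c).2 r
  · intro k hk m hm
    rw [← (hAB k hk m hm).1, ← (hAB k hk m hm).2, ← exists_nthLargest_eq hm,
      ← exists_nthLargest_eq hm]
    simp only [← hA, ← hB]
    exact ⟨Iff.rfl, Iff.rfl⟩

theorem exists_chain_of_flaggedBitableaux (hb : Neutral b) (hcol : IsColumns b P N)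
    (hf : ∀ r, r < d → f (d - 1 - r) = nthLargest N r)
    (hg : ∀ r, r < d → g (d - 1 - r) = nthLargest P r) (t : FlaggedBitableaux n d f g) :
    ∃ bs ∈ chainsBelow n b, IsBitableauOf bs t.2.1.1 t.2.2.1 := by
  obtain ⟨⟨ν, hν⟩, ⟨S, hS⟩, ⟨T, hT⟩⟩ := t
  dsimp only at hS hT ⊢
  have hex : ∀ c, ∃ x, Neutral x ∧ IsColumns x (T.column c) (S.column c) := fun c =>
    exists_word_of_columns ((S.nthLargest_column c).2.trans (T.nthLargest_column c).2.symm)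
  choose x hx hxcol using hex
  -- The flag conditions on a column say that its `r`-th largest entry is at most that of `A`, that
  -- is, that its tail counts are dominated.
  have hflag : ∀ {U : AntiNormalSST ν} {h : ℕ → ℕ} {A : Finset ℕ},
      (∀ r c, (r, c) ∈ ν → U.entry r c ≤ h (d - 1 - r)) →
      (∀ r, r < d → h (d - 1 - r) = nthLargest A r) →
      ∀ c k, numGt (U.column c) k ≤ numGt A k := by
    intro U h A h1 h2 c
    rw [← nthLargest_le_iff]
    intro r
    rw [(U.nthLargest_column c).1]
    by_cases hm : (r, c) ∈ ν
    · rw [← h2 r (mem_rectDiagram.mp (hν hm)).1]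
      exact h1 r c hm
    · rw [U.entry_zero r c hm]
      exact Nat.zero_le _
  refine ⟨List.ofFn fun k : Fin n => x k, ⟨List.length_ofFn, ?_, ?_⟩, ?_⟩
  · intro y hy
    obtain ⟨k, rfl⟩ := List.mem_ofFn.mp hy
    exact hx k
  · rw [List.isChain_iff_pairwise, List.pairwise_cons]
    refine ⟨fun y hy => ?_, List.pairwise_ofFn.mpr fun k l hkl => ?_⟩
    · obtain ⟨k, rfl⟩ := List.mem_ofFn.mp hy
      exact (hcol.dom_iff (hxcol k) hb (hx k)).mpr ⟨hflag hS hf k, hflag hT hg k⟩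
    · exact ((hxcol k).dom_iff (hxcol l) (hx k) (hx l)).mpr
        ⟨S.numGt_column_le hkl, T.numGt_column_le hkl⟩
  · rw [isBitableauOf_iff]
    intro k hk
    rw [List.getElem_ofFn]
    exact hxcol k

end Correspondence

/-! ### Containment and the bijection -/

theorem demazureCrystal_subset {w : Equiv.Perm NZInt} (hw : w ∈ minimalReps)
    {word : List ℤ} (hword : IsReducedWord w word) (n : ℕ) :
    demazureCrystal n word ⊆ crystalNLambda0 n := by
  intro bs hbs
  obtain ⟨b, -, hb⟩ := exists_word_of_minimalReps hw hword
  have h := hbs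
  rw [demazureCrystal_eq_chainsBelow hw hword hb] at h
  exact ⟨h.1, forall_mem_crystalLambda0 hbs, h.2.2.tail⟩

/-- A relation which is total and functional in both directions is the graph of a bijection. -/
theorem exists_equiv_of_relation {α β : Type*} (Q : α → β → Prop) (h1 : ∀ a, ∃ b, Q a b)
    (h2 : ∀ b, ∃ a, Q a b) (h3 : ∀ a b b', Q a b → Q a b' → b = b')
    (h4 : ∀ a a' b, Q a b → Q a' b → a = a') : ∃ F : α ≃ β, ∀ a, Q a (F a) := by
  choose F hF using h1
  refine ⟨Equiv.ofBijective F ⟨fun a a' h => h4 a a' _ (hF a) (h ▸ hF a'), fun b => ?_⟩, hF⟩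
  obtain ⟨a, ha⟩ := h2 b
  exact ⟨a, h3 a _ _ (hF a) ha⟩

end GlInf

theorem mainTheorem7 (w : Equiv.Perm GlInf.NZInt) (hw : w ∈ GlInf.minimalReps)
    (word : List ℤ) (hword : GlInf.IsReducedWord w word) (n : ℕ) (hn : 1 ≤ n) :
    GlInf.demazureCrystal n word ⊆ GlInf.crystalNLambda0 n ∧
    ∃ F : GlInf.demazureCrystal n word ≃
        GlInf.FlaggedBitableaux n (GlInf.diagLength w) (GlInf.flagPhi w) (GlInf.flagPsi w),
      ∀ b : GlInf.demazureCrystal n word,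
        GlInf.IsBitableauOf b.1 (F b).2.1.1 (F b).2.2.1 := by
  refine ⟨GlInf.demazureCrystal_subset hw hword n, ?_⟩
  obtain ⟨b, P, N, hb, hcol, hbw, hd, hlow, hup⟩ := GlInf.exists_word_frobenius hw hword
  have hD := GlInf.demazureCrystal_eq_chainsBelow hw hword hbw n
  -- The flags list the Frobenius coordinates in reverse and the flag index `d - 1 - r` reverses
  -- again, so row `r` from the bottom is bounded by the coordinate with index `r`.
  have hidx : ∀ r, r < GlInf.diagLength w →
      GlInf.diagLength w - 1 - (GlInf.diagLength w - 1 - r) = r := fun r hr => by omega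
  have hf : ∀ r, r < GlInf.diagLength w →
      GlInf.flagPhi w (GlInf.diagLength w - 1 - r) = GlInf.nthLargest N r := fun r hr => by
    rw [GlInf.flagPhi, hidx r hr, hlow r hr]
  have hg : ∀ r, r < GlInf.diagLength w →
      GlInf.flagPsi w (GlInf.diagLength w - 1 - r) = GlInf.nthLargest P r := fun r hr => by
    rw [GlInf.flagPsi, hidx r hr, hup r hr]
  have hmem : ∀ x : GlInf.demazureCrystal n word, x.1 ∈ GlInf.chainsBelow n b := fun x =>
    hD ▸ x.2
  refine GlInf.exists_equiv_of_relation
    (fun (x : GlInf.demazureCrystal n word)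
      (t : GlInf.FlaggedBitableaux n (GlInf.diagLength w) (GlInf.flagPhi w) (GlInf.flagPsi w)) =>
      GlInf.IsBitableauOf x.1 t.2.1.1 t.2.2.1)
    (fun x => GlInf.exists_flaggedBitableaux hb hcol hd hf hg (hmem x)) (fun t => ?_)
    (fun x t t' h h' => GlInf.FlaggedBitableaux.eq_of_isBitableauOf (hmem x).1 h h')
    (fun x x' t h h' => Subtype.ext (GlInf.eq_of_isBitableauOf
      ((hmem x).1.trans (hmem x').1.symm) (hmem x).2.1 (hmem x').2.1 h h'))
  obtain ⟨bs, hbs, h⟩ := GlInf.exists_chain_of_flaggedBitableaux hb hcol hf hg t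
  exact ⟨⟨bs, by rw [hD]; exact hbs⟩, h⟩
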